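/- **Theorem 3.25 (Duality for boolean inverse semigroups).** *Inverse semigroups.* An inverse semigroup is a semigroup $S$ in which every $a$ has a unique $a^{-1}$ with $aa^{-1}a=a$ and $a^{-1}aa^{-1}=a^{-1}$; it is ordered by its natural partial order $a\le b \Leftrightarrow a=ba^{-1}a$. Elements $a,b$ are compatible if $a^{-1}b$ and $ab^{-1}$ are idempotents. An inverse semigroup $S$ with zero is *distributive* if every finite (pairwise) compatible subset has a join and multiplication distributes, on both sides, over the finite joins that exist. It is a *boolean inverse semigroup* if moreover all binary meets exist and its idempotents form a generalized boolean algebra (for idempotents $e\le f$ there is an idempotent $g$ with $eg=0$ and $e\vee g=f$). A *filter* in $S$ is a non-empty subset $F$, not containing $0$, that is upward closed and such that any $a,b\in F$ have a common lower bound in $F$; it is *prime* if $a\vee b\in F$ implies $a\in F$ or $b\in F$ whenever $a \vee b$ exists, and an *ultrafilter* if it is maximal among filters. A *callitic morphism* $\theta\colon S\to T$ of boolean inverse semigroups is a semigroup homomorphism that preserves joins of finite compatible subsets (in particular $\theta(0)=0$) and satisfies: (DC1) if $t\le\theta(s_1),\theta(s_2)$ then there is $s\le s_1,s_2$ with $t\le\theta(s)$;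 (DC2) $\theta^{-1}(P)\neq\emptyset$ for each prime filter $P$ of $T$. *Groupoids.* A groupoid is regarded as a set $G$ with a partial multiplication and an inversion; $\mathbf d(x)=x^{-1}x$, $\mathbf r(x)=xx^{-1}$, and $G_o$ is the set of identities. A topological groupoid is one with a topology making multiplication and inversion continuous; it is *étale* if $\mathbf d\colon G\to G_o$ is a local homeomorphism. A *bisection* is a subset $A\subseteq G$ with $A^{-1}A, AA^{-1}\subseteq G_o$. A *boolean space* is a Hausdorff space with a basis of compact-open sets. A *boolean groupoid* is a Hausdorff étale groupoid with a basis of compact-open bisections and whose space of identities is a boolean space. A functor $\alpha\colon G\to H$ is a *covering functor* if $\mathbf d(g)=\mathbf d(g')$ and $\alpha(g)=\alpha(g')$ imply $g=g'$, and whenever $\alpha(e)=\mathbf d(h)$ with $e\in G_o$, $h \in H$, there is $g\in G$ with $\mathbf d(g)=e$ and $\alpha(g)=h$. A map is *proper* if inverse images of compact sets are compact. *Ultrafilter groupoid.* For a boolean inverse semigroup $S$, $\mathsf G_M(S)$ denotes the set of ultrafilters of $S$ with the topology generated by the sets $\{F : s\in F\}$, $s\in S$, with inverse $F\mapsto F^{-1}$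 and with product $A\cdot B=(AB)^{\uparrow}$, defined exactly when $(A^{-1}A)^{\uparrow}=(BB^{-1})^{\uparrow}$. Here $X^{\uparrow}$ is the set of all elements lying above some element of $X$. *Statement.* The category of boolean inverse semigroups and callitic morphisms is dually equivalent to the category of boolean groupoids and proper continuous covering functors. The functor from boolean inverse semigroups to boolean groupoids giving the equivalence can be taken to be $S\mapsto\mathsf G_M(S)$ on objects (up to isomorphism of topological groupoids) and, under this identification, $\theta\mapsto\theta^{-1}$, $F\mapsto\theta^{-1}(F)$, on morphisms $\theta \colon S\to T$. -/

import Mathlib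

universe u

open CategoryTheory Opposite TopologicalSpace
open scoped Pointwise

namespace NCStone

/-! ### Inverse semigroups and the natural partial order -/

/-- An inverse semigroup: every `a` has a unique generalized inverse `a⁻¹`. -/
class InverseSemigroup (S : Type u) extends Semigroup S, Inv S where
  mul_inv_mul : ∀ a : S, a * a⁻¹ * a = a
  inv_mul_inv : ∀ a : S, a⁻¹ * a * a⁻¹ = a⁻¹
  inv_unique : ∀ a b : S, a * b * a = a → b * a * b = b → b = a⁻¹

/-- An inverse semigroup with a zero element. -/
class InverseSemigroupWithZero (S : Type u) extends InverseSemigroup S, SemigroupWithZero S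

namespace InverseSemigroup

variable {S : Type u} [InverseSemigroup S]

theorem inv_inv' (a : S) : (a⁻¹)⁻¹ = a :=
  (inv_unique a⁻¹ a (inv_mul_inv a) (mul_inv_mul a)).symm

theorem idem_mul {e f : S} (he : e * e = e) (hf : f * f = f) : (e * f) * (e * f) = e * f := by
  have h1 := mul_inv_mul (e * f)
  have h2 := inv_mul_inv (e * f)
  set x := (e * f)⁻¹ with hx
  have h3 : f * x * e = x := by
    refine inv_unique (e * f) (f * x * e) ?_ ?_
    · calc e * f * (f * x * e) * (e * f) = e * (f * f) * x * (e * e) * f := by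
            simp only [mul_assoc]
        _ = e * f * x * (e * f) := by rw [hf, he]; simp only [mul_assoc]
        _ = e * f := h1
    · calc f * x * e * (e * f) * (f * x * e) = f * (x * ((e * e) * (f * f)) * x) * e := by
            simp only [mul_assoc]
        _ = f * x * e := by rw [he, hf, h2]
  have h4 : x * x = x := by
    calc x * x = (f * x * e) * (f * x * e) := by rw [h3]
      _ = f * (x * (e * f) * x) * e := by simp only [mul_assoc]
      _ = x := by rw [h2, h3]
  have h5 : x = x⁻¹ := inv_unique x x (by rw [h4, h4]) (by rw [h4, h4])
  have h6 : e * f = x⁻¹ := inv_unique x (e * f) h2 h1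
  rw [h6, ← h5, h4]

theorem idem_comm {e f : S} (he : e * e = e) (hf : f * f = f) : e * f = f * e := by
  have hef := idem_mul he hf
  have hfe := idem_mul hf he
  have h1 : e * f = (e * f)⁻¹ := inv_unique _ _ (by rw [hef, hef]) (by rw [hef, hef])
  have h2 : f * e = (e * f)⁻¹ := by
    refine inv_unique _ _ ?_ ?_
    · calc e * f * (f * e) * (e * f) = e * (f * f) * (e * e) * f := by simp only [mul_assoc]
        _ = (e * f) * (e * f) := by rw [hf, he]; simp only [mul_assoc]
        _ = e * f := hef
    · calc f * e * (e * f) * (f * e) = f * (e * e) * (f * f) * e := by simp only [mul_assoc]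
        _ = (f * e) * (f * e) := by rw [hf, he]; simp only [mul_assoc]
        _ = f * e := hfe
  rw [h1, ← h2]

theorem idem_inv_mul (a : S) : (a⁻¹ * a) * (a⁻¹ * a) = a⁻¹ * a := by
  rw [← mul_assoc, inv_mul_inv]

theorem idem_mul_inv (a : S) : (a * a⁻¹) * (a * a⁻¹) = a * a⁻¹ := by
  rw [← mul_assoc, mul_inv_mul]

theorem mul_idem_inv (c : S) {f : S} (hf : f * f = f) : (c * f)⁻¹ = f * c⁻¹ := by
  have hc := idem_comm (idem_inv_mul c) hf
  symm
  refine inv_unique _ _ ?_ ?_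
  · calc c * f * (f * c⁻¹) * (c * f) = c * (f * f) * (c⁻¹ * c) * f := by simp only [mul_assoc]
      _ = c * (f * (c⁻¹ * c)) * f := by rw [hf]; simp only [mul_assoc]
      _ = (c * c⁻¹ * c) * (f * f) := by rw [← hc]; simp only [mul_assoc]
      _ = c * f := by rw [hf, mul_inv_mul]
  · calc f * c⁻¹ * (c * f) * (f * c⁻¹) = f * ((c⁻¹ * c) * (f * f)) * c⁻¹ := by
          simp only [mul_assoc]
      _ = f * (f * (c⁻¹ * c)) * c⁻¹ := by rw [hf, hc]
      _ = (f * f) * (c⁻¹ * c * c⁻¹) := by simp only [mul_assoc]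
      _ = f * c⁻¹ := by rw [hf, inv_mul_inv]

theorem le_of_eq_mul_idem {a c f : S} (hf : f * f = f) (h : a = c * f) : a = c * (a⁻¹ * a) := by
  have hc := idem_comm (idem_inv_mul c) hf
  subst h
  rw [mul_idem_inv c hf]
  calc c * f = c * c⁻¹ * c * (f * f) := by rw [mul_inv_mul, hf]
    _ = c * ((c⁻¹ * c) * f * f) := by simp only [mul_assoc]
    _ = c * (f * c⁻¹ * (c * f)) := by rw [hc]; simp only [mul_assoc]

/-- The natural partial order of an inverse semigroup: `a ≤ b` iff `a = b a⁻¹ a`. -/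
instance : PartialOrder S where
  le a b := a = b * (a⁻¹ * a)
  le_refl a := by rw [← mul_assoc, mul_inv_mul]
  le_trans a b c hab hbc := by
    refine le_of_eq_mul_idem (f := (b⁻¹ * b) * (a⁻¹ * a))
      (idem_mul (idem_inv_mul b) (idem_inv_mul a)) ?_
    rw [← mul_assoc, ← hbc]
    exact hab
  le_antisymm a b hab hba := by
    calc a = b * (a⁻¹ * a) := hab
      _ = a * (b⁻¹ * b) * (a⁻¹ * a) := by rw [← hba]
      _ = a * ((a⁻¹ * a) * (b⁻¹ * b)) := by
          rw [idem_comm (idem_inv_mul a) (idem_inv_mul b), mul_assoc]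
      _ = (a * a⁻¹ * a) * (b⁻¹ * b) := by simp only [mul_assoc]
      _ = b := by rw [mul_inv_mul, ← hba]

theorem le_def (a b : S) : a ≤ b ↔ a = b * (a⁻¹ * a) := Iff.rfl

/-- `a` and `b` are compatible: `a⁻¹ b` and `a b⁻¹` are idempotents. -/
def Compat (a b : S) : Prop :=
  IsIdempotentElem (a⁻¹ * b) ∧ IsIdempotentElem (a * b⁻¹)

/-- A set whose elements are pairwise compatible. -/
def IsCompatibleSet (A : Set S) : Prop := ∀ a ∈ A, ∀ b ∈ A, Compat a b

end InverseSemigroup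

open InverseSemigroup

/-! ### Boolean inverse semigroups -/

/-- A distributive inverse semigroup: all finite compatible subsets (the empty one included) have
joins, and multiplication distributes over the finite joins that exist. -/
structure IsDistributive (S : Type u) [InverseSemigroupWithZero S] : Prop where
  exists_join : ∀ A : Set S, A.Finite → IsCompatibleSet A → ∃ a, IsLUB A a
  mul_join : ∀ (A : Set S) (a b : S), A.Finite → IsLUB A a →
    IsLUB ((fun x => b * x) '' A) (b * a)
  join_mul : ∀ (A : Set S) (a b : S), A.Finite → IsLUB A a →
    IsLUB ((fun x => x * b) '' A) (a * b)

/-- A weakly boolean inverse semigroup: a distributive one whose idempotents form a (generalized)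
boolean algebra. The idempotents of a distributive inverse semigroup always form a distributive
lattice with least element `0`, in which the meet of `e` and `f` is `e * f`, so that what is
required is a complement of `e` in each interval `[0, f]` with `e ≤ f`. -/
structure IsWeaklyBoolean (S : Type u) [InverseSemigroupWithZero S] : Prop
    extends IsDistributive S where
  exists_compl : ∀ e f : S, IsIdempotentElem e → IsIdempotentElem f → e ≤ f →
    ∃ g : S, IsIdempotentElem g ∧ e * g = 0 ∧ IsLUB {e, g} f

/-- A boolean inverse semigroup: a weakly boolean one in which all binary meets exist. -/
structure IsBoolean (S : Type u) [InverseSemigroupWithZero S] : Prop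
    extends IsWeaklyBoolean S where
  exists_meet : ∀ a b : S, ∃ c, IsGLB {a, b} c

/-! ### Filters -/

section Filters

variable {S : Type u} [InverseSemigroupWithZero S]

/-- A (proper, non-empty) filter. -/
structure IsProperFilter (F : Set S) : Prop where
  nonempty : F.Nonempty
  upward : ∀ a b : S, a ∈ F → a ≤ b → b ∈ F
  directed : ∀ a b : S, a ∈ F → b ∈ F → ∃ c ∈ F, c ≤ a ∧ c ≤ b
  proper : (0 : S) ∉ F

/-- A prime filter: if `a ∨ b` exists and lies in `F`, then `a ∈ F` or `b ∈ F`. -/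
structure IsPrimeFilter (F : Set S) : Prop extends IsProperFilter F where
  prime : ∀ a b c : S, IsLUB {a, b} c → c ∈ F → a ∈ F ∨ b ∈ F

/-- An ultrafilter: a maximal proper filter. -/
def IsUltra (F : Set S) : Prop := Maximal IsProperFilter F

/-- The upward closure `A↑` of a subset. -/
def up (A : Set S) : Set S := {y | ∃ x ∈ A, x ≤ y}

/-- `d(F) = (F⁻¹F)↑`. -/
def filterDom (F : Set S) : Set S := up (F⁻¹ * F)

/-- `r(F) = (FF⁻¹)↑`. -/
def filterRan (F : Set S) : Set S := up (F * F⁻¹)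

end Filters

/-- The set of ultrafilters of `S`. -/
def UltrafilterSpace (S : Type u) [InverseSemigroupWithZero S] : Type u :=
  {F : Set S // IsUltra F}

/-- The topology on the ultrafilters generated by the sets `X_s = {F | s ∈ F}`. -/
instance (S : Type u) [InverseSemigroupWithZero S] : TopologicalSpace (UltrafilterSpace S) :=
  generateFrom (Set.range fun s : S => {F : UltrafilterSpace S | s ∈ F.1})

/-- The sets `X_s` are in fact a basis. -/
theorem UltrafilterSpace.isTopologicalBasis (S : Type u) [InverseSemigroupWithZero S] :
    IsTopologicalBasis (Set.range fun s : S => {F : UltrafilterSpace S | s ∈ F.1}) where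
  exists_subset_inter := by
    rintro _ ⟨s, rfl⟩ _ ⟨t, rfl⟩ F ⟨hs, ht⟩
    obtain ⟨c, hc, hcs, hct⟩ := F.2.prop.directed s t hs ht
    exact ⟨_, ⟨c, rfl⟩, hc, fun G hG =>
      ⟨G.2.prop.upward _ _ hG hcs, G.2.prop.upward _ _ hG hct⟩⟩
  sUnion_eq := by
    refine Set.eq_univ_of_forall fun F => ?_
    obtain ⟨s, hs⟩ := F.2.prop.nonempty
    exact ⟨_, ⟨s, rfl⟩, hs⟩
  eq_generateFrom := rfl

/-! ### The category of boolean inverse semigroups and callitic morphisms -/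

/-- A callitic morphism: a semigroup homomorphism that preserves the joins of finite compatible
subsets (in particular the zero, which is the empty join) and satisfies
(DC1) if `t ≤ θ s₁` and `t ≤ θ s₂` then `t ≤ θ s` for some `s ≤ s₁, s₂`, and
(DC2) the inverse image of each prime filter is non-empty. -/
@[ext]
structure CalliticHom (S T : Type u) [InverseSemigroupWithZero S]
    [InverseSemigroupWithZero T] where
  toFun : S → T
  map_mul : ∀ a b, toFun (a * b) = toFun a * toFun b
  map_join : ∀ (A : Set S) (a : S), A.Finite → IsCompatibleSet A → IsLUB A a →
    IsLUB (toFun '' A) (toFun a)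
  dc1 : ∀ (s₁ s₂ : S) (t : T), t ≤ toFun s₁ → t ≤ toFun s₂ →
    ∃ s, s ≤ s₁ ∧ s ≤ s₂ ∧ t ≤ toFun s
  dc2 : ∀ P : Set T, IsPrimeFilter P → (toFun ⁻¹' P).Nonempty

namespace CalliticHom

variable {S T U : Type u} [InverseSemigroupWithZero S] [InverseSemigroupWithZero T]
  [InverseSemigroupWithZero U]

theorem zero_le' (a : S) : (0 : S) ≤ a := by
  rw [le_def]; simp

theorem map_inv (θ : CalliticHom S T) (a : S) : θ.toFun a⁻¹ = (θ.toFun a)⁻¹ :=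
  inv_unique _ _ (by rw [← θ.map_mul, ← θ.map_mul, mul_inv_mul])
    (by rw [← θ.map_mul, ← θ.map_mul, inv_mul_inv])

theorem map_le (θ : CalliticHom S T) {a b : S} (h : a ≤ b) : θ.toFun a ≤ θ.toFun b := by
  rw [le_def] at h ⊢
  rw [← θ.map_inv, ← θ.map_mul, ← θ.map_mul, ← h]

theorem map_zero (θ : CalliticHom S T) : θ.toFun 0 = 0 := by
  have h := θ.map_join ∅ 0 Set.finite_empty (fun a ha => ha.elim)
    ⟨fun a ha => ha.elim, fun b _ => zero_le' b⟩
  exact le_antisymm (h.2 fun b hb => by simp at hb) (zero_le' _)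

theorem map_compatible (θ : CalliticHom S T) {A : Set S} (hA : IsCompatibleSet A) :
    IsCompatibleSet (θ.toFun '' A) := by
  rintro _ ⟨a, ha, rfl⟩ _ ⟨b, hb, rfl⟩
  obtain ⟨h1, h2⟩ := hA a ha b hb
  constructor
  · unfold IsIdempotentElem at *
    rw [← θ.map_inv, ← θ.map_mul, ← θ.map_mul, h1]
  · unfold IsIdempotentElem at *
    rw [← θ.map_inv, ← θ.map_mul, ← θ.map_mul, h2]

/-- A callitic morphism preserves all binary meets that exist. -/
theorem map_meet (θ : CalliticHom S T) {a b c : S} (h : IsGLB {a, b} c) :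
    IsGLB {θ.toFun a, θ.toFun b} (θ.toFun c) := by
  constructor
  · rintro _ (rfl | rfl)
    · exact θ.map_le (h.1 (by simp))
    · exact θ.map_le (h.1 (by simp))
  · intro t ht
    obtain ⟨s, hsa, hsb, hts⟩ := θ.dc1 a b t (ht (by simp)) (ht (by simp))
    refine hts.trans (θ.map_le (h.2 ?_))
    rintro _ (rfl | rfl)
    · exact hsa
    · exact hsb

/-- Elements with a common upper bound are compatible. -/
theorem compat_of_le {a b c : S} (ha : a ≤ c) (hb : b ≤ c) : Compat a b := by
  rw [le_def] at ha hb
  have ia := idem_inv_mul a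
  have ib := idem_inv_mul b
  have ic := idem_inv_mul c
  have hai : a⁻¹ = (a⁻¹ * a) * c⁻¹ := by
    conv_lhs => rw [ha, mul_idem_inv c ia]
  have hbi : b⁻¹ = (b⁻¹ * b) * c⁻¹ := by
    conv_lhs => rw [hb, mul_idem_inv c ib]
  constructor
  · have h : a⁻¹ * b = (a⁻¹ * a) * ((c⁻¹ * c) * (b⁻¹ * b)) := by
      conv_lhs => rw [hai, hb]
      simp only [mul_assoc]
    unfold IsIdempotentElem
    rw [h]
    exact idem_mul ia (idem_mul ic ib)
  · have iab := idem_mul ia ib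
    have h : a * b⁻¹ = c * ((a⁻¹ * a) * (b⁻¹ * b)) * (c * ((a⁻¹ * a) * (b⁻¹ * b)))⁻¹ := by
      rw [mul_idem_inv c iab]
      conv_lhs => rw [ha, hbi]
      calc c * (a⁻¹ * a) * (b⁻¹ * b * c⁻¹) = c * ((a⁻¹ * a) * (b⁻¹ * b)) * c⁻¹ := by
            simp only [mul_assoc]
        _ = c * (((a⁻¹ * a) * (b⁻¹ * b)) * ((a⁻¹ * a) * (b⁻¹ * b))) * c⁻¹ := by rw [iab]
        _ = _ := by simp only [mul_assoc]
    unfold IsIdempotentElem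
    rw [h]
    exact idem_mul_inv _

/-- Inverse images of prime filters under callitic morphisms are prime filters. -/
theorem preimage_prime (θ : CalliticHom S T) {P : Set T} (hP : IsPrimeFilter P) :
    IsPrimeFilter (θ.toFun ⁻¹' P) where
  nonempty := θ.dc2 P hP
  upward a b ha hab := hP.upward _ _ ha (θ.map_le hab)
  directed a b ha hb := by
    obtain ⟨c, hc, hca, hcb⟩ := hP.directed _ _ ha hb
    obtain ⟨s, hsa, hsb, hcs⟩ := θ.dc1 a b c hca hcb
    exact ⟨s, hP.upward _ _ hc hcs, hsa, hsb⟩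
  proper h := hP.proper (by rw [Set.mem_preimage, θ.map_zero] at h; exact h)
  prime a b c h hc := by
    refine hP.prime _ _ (θ.toFun c) ?_ hc
    have hle : ∀ x ∈ ({a, b} : Set S), x ≤ c := fun x hx => h.1 hx
    have := θ.map_join {a, b} c (Set.toFinite _)
      (fun x hx y hy => compat_of_le (hle x hx) (hle y hy)) h
    rwa [Set.image_pair] at this

/-- The identity morphism. -/
def id (S : Type u) [InverseSemigroupWithZero S] : CalliticHom S S where
  toFun := fun s => s
  map_mul _ _ := rfl
  map_join A a _ _ h := by simpa using h
  dc1 s₁ s₂ t h₁ h₂ := ⟨t, h₁, h₂, le_rfl⟩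
  dc2 P hP := hP.nonempty

/-- Composition of callitic morphisms. -/
def comp (φ : CalliticHom T U) (θ : CalliticHom S T) : CalliticHom S U where
  toFun := fun s => φ.toFun (θ.toFun s)
  map_mul a b := by rw [θ.map_mul, φ.map_mul]
  map_join A a hf hc h := by
    have := φ.map_join _ _ (hf.image _) (θ.map_compatible hc) (θ.map_join A a hf hc h)
    rwa [Set.image_image] at this
  dc1 s₁ s₂ t h₁ h₂ := by
    obtain ⟨u, hu₁, hu₂, htu⟩ := φ.dc1 _ _ t h₁ h₂
    obtain ⟨s, hs₁, hs₂, hus⟩ := θ.dc1 _ _ u hu₁ hu₂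
    exact ⟨s, hs₁, hs₂, htu.trans (φ.map_le hus)⟩
  dc2 P hP := θ.dc2 _ (φ.preimage_prime hP)

end CalliticHom

/-- A bundled boolean inverse semigroup. -/
structure BooleanInvSemigrp : Type (u + 1) where
  carrier : Type u
  [inst : InverseSemigroupWithZero carrier]
  isBoolean : IsBoolean carrier

instance : CoeSort BooleanInvSemigrp.{u} (Type u) := ⟨BooleanInvSemigrp.carrier⟩

attribute [instance] BooleanInvSemigrp.inst

/-- The category of boolean inverse semigroups and callitic morphisms. -/
instance : Category BooleanInvSemigrp.{u} where
  Hom S T := CalliticHom S T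
  id S := CalliticHom.id S
  comp θ φ := CalliticHom.comp φ θ

/-! ### Groupoids -/

/-- A groupoid, as a set (of arrows) with an involution and a partial multiplication:
`mul x y h` is the product `xy`, which exists when `h : Composable x y`. -/
class SetGroupoid (G : Type u) extends Inv G where
  Composable : G → G → Prop
  mul : ∀ x y : G, Composable x y → G
  inv_inv : ∀ x : G, (x⁻¹)⁻¹ = x
  assoc : ∀ (x y z : G) (hxy : Composable x y) (hyz : Composable y z),
    ∃ (h : Composable (mul x y hxy) z) (h' : Composable x (mul y z hyz)),
      mul (mul x y hxy) z h = mul x (mul y z hyz) h'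
  composable_inv_self : ∀ x : G, Composable x⁻¹ x
  composable_self_inv : ∀ x : G, Composable x x⁻¹
  inv_mul_cancel : ∀ (x y : G) (h : Composable x y),
    ∃ h' : Composable x⁻¹ (mul x y h), mul x⁻¹ (mul x y h) h' = y
  mul_inv_cancel : ∀ (z x : G) (h : Composable z x),
    ∃ h' : Composable (mul z x h) x⁻¹, mul (mul z x h) x⁻¹ h' = z

namespace SetGroupoid

variable {G : Type u} [SetGroupoid G]

/-- `d(x) = x⁻¹x`. -/
def dom (x : G) : G := mul x⁻¹ x (composable_inv_self x)

/-- `r(x) = xx⁻¹`. -/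
def ran (x : G) : G := mul x x⁻¹ (composable_self_inv x)

variable (G) in
/-- The set `G_o` of identities: the elements of the form `xx⁻¹`. -/
def units : Set G := {e | ∃ x : G, e = ran x}

theorem ran_inv (x : G) : ran x⁻¹ = dom x := by
  have h : ∀ y (hy : y = x) (hc : Composable x⁻¹ y), mul x⁻¹ y hc = dom x := by
    rintro y rfl hc; rfl
  exact h _ (inv_inv x) _

theorem dom_mem_units (x : G) : dom x ∈ units G := ⟨x⁻¹, (ran_inv x).symm⟩

/-- The domain map `d : G → G_o`. -/
def domMap (x : G) : units G := ⟨dom x, dom_mem_units x⟩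

/-- A (local) bisection: `A⁻¹A ⊆ G_o` and `AA⁻¹ ⊆ G_o`. -/
def IsBisection (A : Set G) : Prop :=
  (∀ x ∈ A, ∀ y ∈ A, ∀ h : Composable x⁻¹ y, mul x⁻¹ y h ∈ units G) ∧
  (∀ x ∈ A, ∀ y ∈ A, ∀ h : Composable x y⁻¹, mul x y⁻¹ h ∈ units G)

/-- `x = x d(x)`. -/
theorem mul_dom (x : G) : ∃ h : Composable x (dom x), mul x (dom x) h = x := by
  obtain ⟨h, h', e⟩ := assoc x x⁻¹ x (composable_self_inv x) (composable_inv_self x)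
  refine ⟨h', ?_⟩
  have hh : mul x (dom x) h' = mul (mul x x⁻¹ (composable_self_inv x)) x h := e.symm
  rw [hh]
  obtain ⟨h2, e2⟩ := mul_inv_cancel x x⁻¹ (composable_self_inv x)
  have key : ∀ y (hy : y = x) (hc : Composable (mul x x⁻¹ (composable_self_inv x)) y),
      mul (mul x x⁻¹ (composable_self_inv x)) y hc =
        mul (mul x x⁻¹ (composable_self_inv x)) x h := by
    rintro y rfl hc; rfl
  rw [← key _ (inv_inv x) h2, e2]

end SetGroupoid

open SetGroupoid

/-- A topological groupoid: multiplication (on the space of composable pairs) and inversion are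
continuous. -/
structure IsTopologicalGroupoid (G : Type u) [SetGroupoid G] [TopologicalSpace G] : Prop where
  continuous_mul : Continuous fun p : {p : G × G // Composable p.1 p.2} => mul p.1.1 p.1.2 p.2
  continuous_inv : Continuous fun x : G => x⁻¹

/-- An étale groupoid: a topological groupoid whose domain map `d : G → G_o` is a local
homeomorphism. -/
structure IsEtale (G : Type u) [SetGroupoid G] [TopologicalSpace G] : Prop
    extends IsTopologicalGroupoid G where
  isLocalHomeomorph_dom : IsLocalHomeomorph (domMap : G → units G)

/-- A boolean space: a Hausdorff space with a basis of compact-open sets. -/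
def IsBooleanSpace (X : Type u) [TopologicalSpace X] : Prop :=
  T2Space X ∧ IsTopologicalBasis {U : Set X | IsCompact U ∧ IsOpen U}

/-- A boolean groupoid: a Hausdorff étale groupoid with a basis of compact-open bisections whose
space of identities is a boolean space. -/
structure IsBooleanGroupoid (G : Type u) [SetGroupoid G] [TopologicalSpace G] : Prop
    extends IsEtale G where
  t2 : T2Space G
  basis : IsTopologicalBasis {U : Set G | IsCompact U ∧ IsOpen U ∧ IsBisection U}
  units_boolean : IsBooleanSpace (units G)

/-! ### The category of boolean groupoids and proper continuous covering functors -/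

/-- A proper continuous covering functor. The field `map_mul` says that it is a functor; `star_inj`
and `star_surj` say that it is a covering; `proper` says that inverse images of compact sets are
compact. -/
@[ext]
structure ProperCoveringFunctor (G H : Type u) [SetGroupoid G] [TopologicalSpace G]
    [SetGroupoid H] [TopologicalSpace H] where
  toFun : G → H
  map_mul : ∀ (x y : G) (h : Composable x y),
    ∃ h' : Composable (toFun x) (toFun y), toFun (mul x y h) = mul (toFun x) (toFun y) h'
  star_inj : ∀ g g' : G, dom g = dom g' → toFun g = toFun g' → g = g'
  star_surj : ∀ (e : G) (h : H), e ∈ units G → toFun e = dom h →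
    ∃ g : G, dom g = e ∧ toFun g = h
  continuous : Continuous toFun
  proper : ∀ K : Set H, IsCompact K → IsCompact (toFun ⁻¹' K)

namespace ProperCoveringFunctor

variable {G H K : Type u} [SetGroupoid G] [TopologicalSpace G] [SetGroupoid H]
  [TopologicalSpace H] [SetGroupoid K] [TopologicalSpace K]

/-- Functors preserve `d`. -/
theorem map_dom (f : ProperCoveringFunctor G H) (x : G) : f.toFun (dom x) = dom (f.toFun x) := by
  obtain ⟨h, e⟩ := mul_dom x
  obtain ⟨h', e'⟩ := f.map_mul x (dom x) h
  obtain ⟨h2, e2⟩ := SetGroupoid.inv_mul_cancel (f.toFun x) (f.toFun (dom x)) h'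
  rw [e] at e'
  have key : ∀ y (hy : y = f.toFun x) (hc : Composable (f.toFun x)⁻¹ y),
      mul (f.toFun x)⁻¹ y hc = dom (f.toFun x) := by
    rintro y rfl hc; rfl
  rw [← e2, key _ e'.symm h2]

/-- Functors preserve identities. -/
theorem map_units (f : ProperCoveringFunctor G H) {e : G} (he : e ∈ units G) :
    f.toFun e ∈ units H := by
  obtain ⟨x, rfl⟩ := he
  have h : ran x = dom x⁻¹ := by rw [← ran_inv, SetGroupoid.inv_inv]
  rw [h, f.map_dom]
  exact dom_mem_units _

/-- The identity functor. -/
def id (G : Type u) [SetGroupoid G] [TopologicalSpace G] : ProperCoveringFunctor G G where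
  toFun := fun g => g
  map_mul _ _ h := ⟨h, rfl⟩
  star_inj _ _ _ h := h
  star_surj _ h _ he := ⟨h, he.symm, rfl⟩
  continuous := continuous_id
  proper _ hK := hK

/-- Composition of proper continuous covering functors. -/
def comp (f' : ProperCoveringFunctor H K) (f : ProperCoveringFunctor G H) :
    ProperCoveringFunctor G K where
  toFun := fun g => f'.toFun (f.toFun g)
  map_mul x y h := by
    obtain ⟨h₁, e₁⟩ := f.map_mul x y h
    obtain ⟨h₂, e₂⟩ := f'.map_mul _ _ h₁
    exact ⟨h₂, by rw [e₁, e₂]⟩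
  star_inj g g' hd hg := by
    refine f.star_inj g g' hd (f'.star_inj _ _ ?_ hg)
    rw [← f.map_dom, ← f.map_dom, hd]
  star_surj e k he hk := by
    obtain ⟨h, hh, rfl⟩ := f'.star_surj _ k (f.map_units he) hk
    obtain ⟨g, hg, rfl⟩ := f.star_surj e h he hh.symm
    exact ⟨g, hg, rfl⟩
  continuous := f'.continuous.comp f.continuous
  proper C hC := f.proper _ (f'.proper C hC)

end ProperCoveringFunctor

/-- A bundled boolean groupoid. -/
structure BooleanGrpd : Type (u + 1) where
  carrier : Type u
  [instGroupoid : SetGroupoid carrier]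
  [instTop : TopologicalSpace carrier]
  isBoolean : IsBooleanGroupoid carrier

instance : CoeSort BooleanGrpd.{u} (Type u) := ⟨BooleanGrpd.carrier⟩

attribute [instance] BooleanGrpd.instGroupoid BooleanGrpd.instTop

/-- The category of boolean groupoids and proper continuous covering functors. -/
instance : Category BooleanGrpd.{u} where
  Hom G H := ProperCoveringFunctor G H
  id G := ProperCoveringFunctor.id G
  comp f f' := ProperCoveringFunctor.comp f' f

/-- The homeomorphism `φ` identifies the topological groupoid `G` with the groupoid of ultrafilters
of `S`, in which `A·B` is defined iff `d(A) = r(B)`, in which case `A·B = (AB)↑`, and in which the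
inverse of `A` is `A⁻¹`. -/
structure IsUltrafilterGroupoid {S G : Type u} [InverseSemigroupWithZero S] [SetGroupoid G]
    [TopologicalSpace G] (φ : G ≃ₜ UltrafilterSpace S) : Prop where
  composable_iff : ∀ g h : G, Composable g h ↔ filterDom (φ g).1 = filterRan (φ h).1
  map_mul : ∀ (g h : G) (hc : Composable g h), (φ (mul g h hc)).1 = up ((φ g).1 * (φ h).1)
  map_inv : ∀ g : G, (φ g⁻¹).1 = (φ g).1⁻¹

end NCStone

open NCStone

/-!
The functor `ultrafilterFunctor` sends a boolean inverse semigroup `S` to its space of ultrafilters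
and `θ` to `F ↦ θ⁻¹(F)`; it is shown to be faithful, full and essentially surjective.

*The groupoid structure.* Up-closed sets multiply by `X ∘ Y = (XY)↑`, which is associative, and a
filter satisfies `F ∘ F⁻¹ ∘ F = F`; the groupoid laws are formal consequences. A product `A · B` of
ultrafilters is the translate of `B` by any element `a` of `A`, and translation by `a` is an order
isomorphism between families of filters, with inverse the translation by `a⁻¹`. So products of
ultrafilters are again ultrafilters (`ActsOn.ultra`, `IsUltra.up_mul`).

*Ultrafilters are the prime filters.* In a boolean inverse semigroup, relative complements show that
prime filters are maximal (`IsPrimeFilter.ultra`), and distributivity that ultrafilters are prime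
for finite joins (`IsUltra.exists_mem_of_isLUB`). Hence the sets `{F | s ∈ F}` determine `s`
(`basicOpen_injective`). They are compact (`isCompact_basicOpen`): if an ultrafilter `𝒰` on the
space contains one of them, the `t` with `{F | t ∈ F} ∈ 𝒰` form a prime filter of `S`, which is
a limit of `𝒰`. It follows that the groupoid is boolean, and that its compact-open bisections are precisely
the sets `{F | s ∈ F}` (`exists_eq_basicOpen`).

*The inverse construction.* The compact-open bisections of a boolean groupoid `G` form a boolean
inverse semigroup, ordered by inclusion, with unions as joins. Its ultrafilters have a common point
by compactness, so they are the families of all compact-open bisections through a given arrow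
(`CompactOpenBisection.point_surjective`); this makes `G` isomorphic to their groupoid (`pointIso`),
which is essential surjectivity. Inverse images under a proper covering functor form a callitic
morphism (`CompactOpenBisection.comapHom`), and composing it with the isomorphisms `s ↦ {F | s ∈ F}`
(`basicOpenEquiv`) gives fullness.
-/

namespace NCStone

/-! ### Algebra and order in inverse semigroups -/

namespace InverseSemigroup

variable {S : Type u} [InverseSemigroup S]

theorem mul_inv_rev' (a b : S) : (a * b)⁻¹ = b⁻¹ * a⁻¹ := by
  have hc : (a⁻¹ * a) * (b * b⁻¹) = (b * b⁻¹) * (a⁻¹ * a) :=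
    idem_comm (idem_inv_mul a) (idem_mul_inv b)
  symm
  refine inv_unique _ _ ?_ ?_
  · calc a * b * (b⁻¹ * a⁻¹) * (a * b) = a * ((b * b⁻¹) * (a⁻¹ * a)) * b := by
          simp only [mul_assoc]
      _ = (a * a⁻¹ * a) * (b * b⁻¹ * b) := by rw [← hc]; simp only [mul_assoc]
      _ = a * b := by rw [mul_inv_mul, mul_inv_mul]
  · calc b⁻¹ * a⁻¹ * (a * b) * (b⁻¹ * a⁻¹) = b⁻¹ * ((a⁻¹ * a) * (b * b⁻¹)) * a⁻¹ := by
          simp only [mul_assoc]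
      _ = (b⁻¹ * b * b⁻¹) * (a⁻¹ * a * a⁻¹) := by rw [hc]; simp only [mul_assoc]
      _ = b⁻¹ * a⁻¹ := by rw [inv_mul_inv, inv_mul_inv]

theorem idem_inv {e : S} (he : e * e = e) : e⁻¹ = e :=
  (inv_unique e e (by rw [he, he]) (by rw [he, he])).symm

theorem mul_idem_le (a : S) {f : S} (hf : f * f = f) : a * f ≤ a :=
  le_of_eq_mul_idem hf rfl

theorem idem_conj (a : S) {f : S} (hf : f * f = f) :
    (a * f * a⁻¹) * (a * f * a⁻¹) = a * f * a⁻¹ := by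
  have h := idem_mul_inv (a * f)
  have h2 : a * f * (a * f)⁻¹ = a * f * a⁻¹ := by
    rw [mul_idem_inv a hf, ← mul_assoc, mul_assoc a f f, hf]
  rwa [h2] at h

theorem mul_idem_eq (a : S) {f : S} (hf : f * f = f) : a * f = (a * f * a⁻¹) * a := by
  have hc := idem_comm (idem_inv_mul a) hf
  calc a * f = (a * a⁻¹ * a) * f := by rw [mul_inv_mul]
    _ = a * ((a⁻¹ * a) * f) := by simp only [mul_assoc]
    _ = _ := by rw [hc]; simp only [mul_assoc]

theorem idem_mul_eq (a : S) {e : S} (he : e * e = e) : e * a = a * (a⁻¹ * e * a) := by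
  have hc := idem_comm (idem_mul_inv a) he
  calc e * a = e * (a * a⁻¹ * a) := by rw [mul_inv_mul]
    _ = (e * (a * a⁻¹)) * a := by simp only [mul_assoc]
    _ = _ := by rw [← hc]; simp only [mul_assoc]

theorem idem_mul_le (a : S) {e : S} (he : e * e = e) : e * a ≤ a := by
  rw [idem_mul_eq a he]
  have := idem_conj a⁻¹ he
  rw [inv_inv'] at this
  exact mul_idem_le a this

theorem mul_le_mul_left' {a b : S} (h : a ≤ b) (c : S) : c * a ≤ c * b := by
  rw [le_def] at h
  rw [h, ← mul_assoc]
  exact mul_idem_le _ (idem_inv_mul a)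

theorem mul_le_mul_right' {a b : S} (h : a ≤ b) (c : S) : a * c ≤ b * c := by
  rw [le_def] at h
  rw [h, mul_idem_eq b (idem_inv_mul a), mul_assoc]
  exact idem_mul_le _ (idem_conj b (idem_inv_mul a))

theorem mul_le_mul'' {a b c d : S} (h : a ≤ b) (h' : c ≤ d) : a * c ≤ b * d :=
  (mul_le_mul_right' h c).trans (mul_le_mul_left' h' b)

theorem inv_le_inv'' {a b : S} (h : a ≤ b) : a⁻¹ ≤ b⁻¹ := by
  rw [le_def] at h
  rw [h, mul_idem_inv b (idem_inv_mul a)]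
  exact idem_mul_le _ (idem_inv_mul a)

theorem inv_mul_mul_le (a z : S) : a⁻¹ * a * z ≤ z := idem_mul_le z (idem_inv_mul a)

theorem mul_inv_mul_le (a z : S) : a * (a⁻¹ * z) ≤ z := by
  rw [← mul_assoc]; exact idem_mul_le z (idem_mul_inv a)

theorem idem_of_le {a e : S} (he : e * e = e) (h : a ≤ e) : a * a = a := by
  rw [le_def] at h
  rw [h]
  exact idem_mul he (idem_inv_mul a)

theorem inv_mul_le {a b : S} (h : a ≤ b) : a⁻¹ * a ≤ b⁻¹ * b :=
  mul_le_mul'' (inv_le_inv'' h) h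

/-- For idempotents, the product is the meet. -/
theorem le_idem_mul {x e f : S} (he : e * e = e) (h : x ≤ e) (h' : x ≤ f) :
    x ≤ e * f := by
  have := mul_le_mul'' h h'
  rwa [idem_of_le he h] at this

theorem le_iff_exists_idem {a b : S} : a ≤ b ↔ ∃ f : S, f * f = f ∧ a = b * f :=
  ⟨fun h => ⟨_, idem_inv_mul a, h⟩, fun ⟨_, hf, h⟩ => le_of_eq_mul_idem hf h⟩

end InverseSemigroup

open InverseSemigroup CalliticHom SetGroupoid

section Up

variable {S : Type u} [InverseSemigroupWithZero S]

/-! ### Upward closed sets and the groupoid of ultrafilters -/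

theorem subset_up (A : Set S) : A ⊆ up A := fun a ha => ⟨a, ha, le_rfl⟩

theorem up_mono {A B : Set S} (h : A ⊆ B) : up A ⊆ up B := fun _ ⟨x, hx, hy⟩ => ⟨x, h hx, hy⟩

theorem up_mul_up_left (A B : Set S) : up (up A * B) = up (A * B) := by
  refine Set.Subset.antisymm ?_ (up_mono (Set.mul_subset_mul_right (subset_up A)))
  rintro z ⟨_, ⟨x, ⟨a, ha, hax⟩, b, hb, rfl⟩, hz⟩
  exact ⟨a * b, Set.mul_mem_mul ha hb, (mul_le_mul_right' hax b).trans hz⟩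

theorem up_mul_up_right (A B : Set S) : up (A * up B) = up (A * B) := by
  refine Set.Subset.antisymm ?_ (up_mono (Set.mul_subset_mul_left (subset_up B)))
  rintro z ⟨_, ⟨a, ha, y, ⟨b, hb, hby⟩, rfl⟩, hz⟩
  exact ⟨a * b, Set.mul_mem_mul ha hb, (mul_le_mul_left' hby a).trans hz⟩

theorem up_inv (A : Set S) : (up A)⁻¹ = up A⁻¹ := by
  ext z
  constructor
  · rintro ⟨a, ha, h⟩
    exact ⟨a⁻¹, by simpa [inv_inv'] using ha, by simpa [inv_inv'] using inv_le_inv'' h⟩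
  · rintro ⟨a, ha, h⟩
    exact ⟨a⁻¹, ha, inv_le_inv'' h⟩

theorem set_inv_inv (A : Set S) : (A⁻¹)⁻¹ = A := by
  ext z; simp [inv_inv']

theorem inv_mem_set_inv {A : Set S} {a : S} (ha : a ∈ A) : a⁻¹ ∈ A⁻¹ := by
  rwa [Set.mem_inv, inv_inv']

theorem set_mul_inv (A B : Set S) : (A * B)⁻¹ = B⁻¹ * A⁻¹ := by
  ext z
  simp only [Set.mem_inv, Set.mem_mul]
  constructor
  · rintro ⟨a, ha, b, hb, h⟩
    refine ⟨b⁻¹, by simpa [inv_inv'] using hb, a⁻¹, by simpa [inv_inv'] using ha, ?_⟩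
    rw [← mul_inv_rev', h, inv_inv']
  · rintro ⟨b, hb, a, ha, rfl⟩
    exact ⟨_, ha, _, hb, (mul_inv_rev' _ _).symm⟩

theorem up_mul_inv (A B : Set S) : (up (A * B))⁻¹ = up (B⁻¹ * A⁻¹) := by
  rw [up_inv, set_mul_inv]

theorem IsProperFilter.inv {F : Set S} (hF : IsProperFilter F) : IsProperFilter F⁻¹ where
  nonempty := by
    obtain ⟨a, ha⟩ := hF.nonempty
    exact ⟨a⁻¹, by simpa [inv_inv'] using ha⟩
  upward a b ha hab := hF.upward _ _ ha (inv_le_inv'' hab)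
  directed a b ha hb := by
    obtain ⟨c, hc, hca, hcb⟩ := hF.directed _ _ ha hb
    refine ⟨c⁻¹, by simpa [inv_inv'] using hc, ?_, ?_⟩
    · simpa [inv_inv'] using inv_le_inv'' hca
    · simpa [inv_inv'] using inv_le_inv'' hcb
  proper h := hF.proper (by
    have h0 : (0 : S)⁻¹ = 0 := idem_inv (zero_mul 0)
    rwa [Set.mem_inv, h0] at h)

theorem IsUltra.inv {F : Set S} (hF : IsUltra F) : IsUltra F⁻¹ := by
  refine ⟨hF.prop.inv, fun C hC hle => ?_⟩
  have h1 : F ⊆ C⁻¹ := fun x hx => hle (by simpa [inv_inv'] using hx)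
  have h2 := hF.le_of_ge hC.inv h1
  intro x hx
  exact h2 (by simpa [inv_inv'] using hx)

/-- A filter contains `a b⁻¹ c` along with `a`, `b`, `c`. -/
theorem IsProperFilter.up_mul_inv_mul {F : Set S} (hF : IsProperFilter F) :
    up (F * F⁻¹ * F) = F := by
  ext z
  constructor
  · rintro ⟨_, ⟨_, ⟨a, ha, b, hb, rfl⟩, c, hc, rfl⟩, hz⟩
    obtain ⟨x, hx, hxa, hxb⟩ := hF.directed a b⁻¹ ha hb
    obtain ⟨y, hy, hyx, hyc⟩ := hF.directed x c hx hc
    refine hF.upward _ _ hy (le_trans ?_ hz)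
    have : y * y⁻¹ * y ≤ a * b * c :=
      mul_le_mul'' (mul_le_mul'' (hyx.trans hxa)
        (by simpa [inv_inv'] using inv_le_inv'' (hyx.trans hxb))) hyc
    rwa [mul_inv_mul] at this
  · intro hz
    exact ⟨z * z⁻¹ * z, Set.mul_mem_mul (Set.mul_mem_mul hz (inv_mem_set_inv hz)) hz,
      by rw [mul_inv_mul]⟩

/-- The translate `(aF)↑` of a filter `F`, written as `{z | a⁻¹ z ∈ F}`; the two agree when
`a⁻¹ a` acts trivially on the left of `F`. -/
def translate (a : S) (F : Set S) : Set S := {z | a⁻¹ * z ∈ F}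

/-- The element `a` can be applied to the filter `F`: the idempotent `a⁻¹ a` lies in
`r(F) = (FF⁻¹)↑`. -/
def ActsOn (a : S) (F : Set S) : Prop := ∃ b ∈ F, a⁻¹ * a * b ∈ F

theorem ActsOn.mul_mem {a : S} {F : Set S} (h : ActsOn a F) (hF : IsProperFilter F) {b : S}
    (hb : b ∈ F) : a⁻¹ * a * b ∈ F := by
  obtain ⟨b', -, hb'⟩ := h
  obtain ⟨c, hc, hcb, hcb'⟩ := hF.directed _ _ hb hb'
  refine hF.upward _ _ hc ?_
  obtain ⟨f, hf, rfl⟩ := le_iff_exists_idem.1 hcb'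
  have := mul_le_mul_left' hcb (a⁻¹ * a)
  rwa [← mul_assoc, ← mul_assoc (a⁻¹ * a), idem_inv_mul] at this

theorem ActsOn.mem_translate {a : S} {F : Set S} (h : ActsOn a F) (hF : IsProperFilter F) {z : S} :
    z ∈ translate a F ↔ ∃ b ∈ F, a * b ≤ z := by
  constructor
  · exact fun hz => ⟨_, hz, mul_inv_mul_le a z⟩
  · rintro ⟨b, hb, hz⟩
    refine hF.upward _ _ (h.mul_mem hF hb) ?_
    rw [mul_assoc]
    exact mul_le_mul_left' hz _

theorem ActsOn.isProperFilter_translate {a : S} {F : Set S} (h : ActsOn a F)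
    (hF : IsProperFilter F) : IsProperFilter (translate a F) where
  nonempty := by
    obtain ⟨b, hb⟩ := hF.nonempty
    exact ⟨a * b, (h.mem_translate hF).2 ⟨b, hb, le_rfl⟩⟩
  upward x y hx hxy := hF.upward _ _ hx (mul_le_mul_left' hxy _)
  directed x y hx hy := by
    obtain ⟨c, hc, hcx, hcy⟩ := hF.directed _ _ hx hy
    exact ⟨a * c, (h.mem_translate hF).2 ⟨c, hc, le_rfl⟩,
      (mul_le_mul_left' hcx a).trans (mul_inv_mul_le a x),
      (mul_le_mul_left' hcy a).trans (mul_inv_mul_le a y)⟩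
  proper h := hF.proper (by simpa [translate] using h)

theorem ActsOn.inv_translate {a : S} {F : Set S} (h : ActsOn a F) (hF : IsProperFilter F) :
    ActsOn a⁻¹ (translate a F) := by
  obtain ⟨b, hb⟩ := hF.nonempty
  refine ⟨a * b, (h.mem_translate hF).2 ⟨b, hb, le_rfl⟩, (h.mem_translate hF).2 ⟨b, hb, ?_⟩⟩
  rw [inv_inv', ← mul_assoc, mul_inv_mul]

theorem ActsOn.translate_inv_translate {a : S} {F : Set S} (h : ActsOn a F)
    (hF : IsProperFilter F) :
    translate a⁻¹ (translate a F) = F := by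
  ext z
  simp only [translate, Set.mem_ofPred_eq, inv_inv', ← mul_assoc]
  exact ⟨fun hz => hF.upward _ _ hz (inv_mul_mul_le a z), fun hz => h.mul_mem hF hz⟩

/-- Translation is an order isomorphism between filters, so it preserves maximality. -/
theorem ActsOn.ultra {a : S} {F : Set S} (h : ActsOn a F) (hF : IsUltra F) :
    IsUltra (translate a F) := by
  refine ⟨h.isProperFilter_translate hF.prop, fun C hC hle => ?_⟩
  have hact : ActsOn a⁻¹ C := by
    obtain ⟨b, hb, hb'⟩ := h.inv_translate hF.prop
    exact ⟨b, hle hb, hle hb'⟩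
  have hmono : F ⊆ translate a⁻¹ C := by
    rw [← h.translate_inv_translate hF.prop]
    exact fun z hz => hle hz
  have h1 := hF.le_of_ge (hact.isProperFilter_translate hC) hmono
  have h2 := hact.translate_inv_translate hC
  rw [inv_inv'] at h2
  intro z hz
  rw [← h2] at hz
  exact h1 hz

theorem mem_filterDom_of_mem {F : Set S} {a : S} (ha : a ∈ F) : a⁻¹ * a ∈ filterDom F :=
  subset_up _ (Set.mul_mem_mul (inv_mem_set_inv ha) ha)

theorem mem_filterRan_of_mem {F : Set S} {a : S} (ha : a ∈ F) : a * a⁻¹ ∈ filterRan F :=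
  subset_up _ (Set.mul_mem_mul ha (inv_mem_set_inv ha))

theorem IsProperFilter.mul_mem_of_mem_ran {F : Set S} (hF : IsProperFilter F) {x b : S}
    (hx : x ∈ filterRan F) (hb : b ∈ F) : x * b ∈ F := by
  rw [← hF.up_mul_inv_mul, ← up_mul_up_left]
  exact subset_up _ (Set.mul_mem_mul hx hb)

theorem IsProperFilter.actsOn {F : Set S} (hF : IsProperFilter F) {a : S}
    (ha : a⁻¹ * a ∈ filterRan F) : ActsOn a F := by
  obtain ⟨b, hb⟩ := hF.nonempty
  exact ⟨b, hb, hF.mul_mem_of_mem_ran ha hb⟩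

/-- A product of composable filters is the translate by any element of the left factor. -/
theorem up_mul_eq_translate {A B : Set S} (hB : IsProperFilter B)
    (h : filterDom A = filterRan B) {a : S} (ha : a ∈ A) : up (A * B) = translate a B := by
  have hact : ActsOn a B := hB.actsOn (h ▸ mem_filterDom_of_mem ha)
  ext z
  rw [hact.mem_translate hB]
  constructor
  · rintro ⟨_, ⟨a', ha', b, hb, rfl⟩, hz⟩
    have h1 : a⁻¹ * a' ∈ filterRan B := by
      rw [← h]
      exact subset_up _ (Set.mul_mem_mul (inv_mem_set_inv ha) ha')
    refine ⟨_, hB.mul_mem_of_mem_ran h1 hb, le_trans ?_ hz⟩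
    rw [mul_assoc]
    exact mul_inv_mul_le _ _
  · rintro ⟨b, hb, hz⟩
    exact ⟨_, Set.mul_mem_mul ha hb, hz⟩

theorem IsUltra.up_mul {A B : Set S} (hA : IsUltra A) (hB : IsUltra B)
    (h : filterDom A = filterRan B) : IsUltra (up (A * B)) := by
  obtain ⟨a, ha⟩ := hA.prop.nonempty
  rw [up_mul_eq_translate hB.prop h ha]
  exact (hB.prop.actsOn (h ▸ mem_filterDom_of_mem ha)).ultra hB

theorem filterDom_inv (A : Set S) : filterDom A⁻¹ = filterRan A := by
  rw [filterDom, set_inv_inv, filterRan]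

theorem filterRan_inv (A : Set S) : filterRan A⁻¹ = filterDom A := by
  rw [filterRan, set_inv_inv, filterDom]

theorem filterDom_up_mul {A B : Set S} (hB : IsProperFilter B)
    (h : filterDom A = filterRan B) : filterDom (up (A * B)) = filterDom B := by
  calc filterDom (up (A * B)) = up (B⁻¹ * A⁻¹ * (A * B)) := by
        rw [filterDom, up_mul_inv, up_mul_up_left, up_mul_up_right]
    _ = up (B⁻¹ * (A⁻¹ * A) * B) := by simp only [mul_assoc]
    _ = up (B⁻¹ * filterDom A * B) := by
        rw [filterDom, ← up_mul_up_left, ← up_mul_up_right (B⁻¹), up_mul_up_left]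
    _ = up (B⁻¹ * (B * B⁻¹) * B) := by
        rw [h, filterRan, ← up_mul_up_left, up_mul_up_right, up_mul_up_left]
    _ = up (B⁻¹ * up (B * B⁻¹ * B)) := by rw [up_mul_up_right]; simp only [mul_assoc]
    _ = filterDom B := by rw [hB.up_mul_inv_mul, filterDom]

theorem filterRan_up_mul {A B : Set S} (hA : IsProperFilter A)
    (h : filterDom A = filterRan B) : filterRan (up (A * B)) = filterRan A := by
  have := filterDom_up_mul (A := B⁻¹) (B := A⁻¹) hA.inv
    (by rw [filterDom_inv, filterRan_inv, h])
  rwa [← up_mul_inv, filterDom_inv, filterDom_inv] at this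

/-- The groupoid of ultrafilters. -/
instance UltrafilterSpace.instSetGroupoid : SetGroupoid (UltrafilterSpace S) where
  inv F := ⟨F.1⁻¹, F.2.inv⟩
  Composable A B := filterDom A.1 = filterRan B.1
  mul A B h := ⟨up (A.1 * B.1), A.2.up_mul B.2 h⟩
  inv_inv A := Subtype.ext (set_inv_inv A.1)
  assoc A B C hAB hBC := by
    refine ⟨(filterDom_up_mul B.2.prop hAB).trans hBC,
      hAB.trans (filterRan_up_mul B.2.prop hBC).symm, Subtype.ext ?_⟩
    change up (up (A.1 * B.1) * C.1) = up (A.1 * up (B.1 * C.1))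
    rw [up_mul_up_left, up_mul_up_right, mul_assoc]
  composable_inv_self A := filterDom_inv A.1
  composable_self_inv A := (filterRan_inv A.1).symm
  inv_mul_cancel A B h := by
    refine ⟨(filterDom_inv A.1).trans (filterRan_up_mul A.2.prop h).symm, Subtype.ext ?_⟩
    change up (A.1⁻¹ * up (A.1 * B.1)) = B.1
    rw [up_mul_up_right, ← mul_assoc, ← up_mul_up_left]
    change up (filterDom A.1 * B.1) = B.1
    rw [h, filterRan, up_mul_up_left, B.2.prop.up_mul_inv_mul]
  mul_inv_cancel A B h := by
    refine ⟨(filterDom_up_mul B.2.prop h).trans (filterRan_inv B.1).symm, Subtype.ext ?_⟩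
    change up (up (A.1 * B.1) * B.1⁻¹) = A.1
    rw [up_mul_up_left, mul_assoc, ← up_mul_up_right]
    change up (A.1 * filterRan B.1) = A.1
    rw [← h, filterDom, up_mul_up_right, ← mul_assoc, A.2.prop.up_mul_inv_mul]

theorem UltrafilterSpace.eq_of_subset {F F' : UltrafilterSpace S} (h : F.1 ⊆ F'.1) : F = F' :=
  Subtype.ext (F.2.eq_of_ge F'.2.prop h).symm

/-- An ultrafilter is an identity of the groupoid exactly when it contains an idempotent. -/
theorem UltrafilterSpace.mem_units_iff {F : UltrafilterSpace S} :
    F ∈ units (UltrafilterSpace S) ↔ ∃ e ∈ F.1, e * e = e := by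
  constructor
  · rintro ⟨A, rfl⟩
    obtain ⟨a, ha⟩ := A.2.prop.nonempty
    exact ⟨_, mem_filterRan_of_mem ha, idem_mul_inv a⟩
  · rintro ⟨e, he, hee⟩
    refine ⟨F, eq_of_subset fun x hx => ?_⟩
    obtain ⟨c, hc, hcx, hce⟩ := F.2.prop.directed _ _ hx he
    have hcc := idem_of_le hee hce
    refine ⟨c * c⁻¹, Set.mul_mem_mul hc (inv_mem_set_inv hc), ?_⟩
    rwa [idem_inv hcc, hcc]

/-- An ultrafilter is determined by its domain and any one of its elements. -/
theorem UltrafilterSpace.eq_of_dom_eq {F F' : UltrafilterSpace S} {a : S}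
    (h : filterDom F.1 = filterDom F'.1) (ha : a ∈ F.1) (ha' : a ∈ F'.1) : F = F' := by
  refine eq_of_subset fun x hx => ?_
  have hc : filterDom F'.1 = filterRan F'.1⁻¹ := (filterRan_inv _).symm
  have hx' : a⁻¹ * x ∈ filterDom F'.1 := by
    rw [← h]
    exact subset_up _ (Set.mul_mem_mul (inv_mem_set_inv ha) hx)
  rw [← F'.2.prop.up_mul_inv_mul, mul_assoc, ← up_mul_up_right]
  exact ⟨a * (a⁻¹ * x), Set.mul_mem_mul ha' hx', mul_inv_mul_le a x⟩

/-- The translate by `a` of the identity `E ∋ a⁻¹ a` is the arrow with domain `E` that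
contains `a`. -/
theorem exists_ultra_of_mem_units {E : UltrafilterSpace S}
    (hE : E ∈ units (UltrafilterSpace S)) {a : S} (ha : a⁻¹ * a ∈ E.1) :
    ∃ F : UltrafilterSpace S, a ∈ F.1 ∧ filterDom F.1 = E.1 := by
  have hact : ActsOn a E.1 := ⟨_, ha, by rwa [idem_inv_mul]⟩
  refine ⟨⟨translate a E.1, hact.ultra E.2⟩, ha, ?_⟩
  have hF : IsUltra (translate a E.1) := hact.ultra E.2
  let F : UltrafilterSpace S := ⟨translate a E.1, hF⟩
  refine (congrArg Subtype.val (UltrafilterSpace.eq_of_subset (F := E)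
    (F' := dom F) fun x hx => ?_)).symm
  obtain ⟨e, he, hee⟩ := UltrafilterSpace.mem_units_iff.1 hE
  obtain ⟨c, hc, hcx, hce⟩ := E.2.prop.directed _ _ hx he
  have hcc := idem_of_le hee hce
  refine ⟨(a * c)⁻¹ * (a * c), Set.mul_mem_mul ?_ ?_, ?_⟩
  · exact inv_mem_set_inv ((hact.mem_translate E.2.prop).2 ⟨c, hc, le_rfl⟩)
  · exact (hact.mem_translate E.2.prop).2 ⟨c, hc, le_rfl⟩
  · rw [mul_idem_inv a hcc]
    refine le_trans ?_ hcx
    calc c * a⁻¹ * (a * c) = c * (a⁻¹ * a * c) := by simp only [mul_assoc]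
      _ ≤ c * c := mul_le_mul_left' (inv_mul_mul_le a c) c
      _ = c := hcc

/-- If `a b ∈ F` then `F = A · B` with `a ∈ A` and `b ∈ B`. -/
theorem UltrafilterSpace.exists_mul_of_mul_mem {F : UltrafilterSpace S} {a b : S}
    (h : a * b ∈ F.1) :
    ∃ (A B : UltrafilterSpace S) (hc : Composable A B), a ∈ A.1 ∧ b ∈ B.1 ∧ mul A B hc = F := by
  have hact : ActsOn a⁻¹ F.1 := ⟨a * b, h, by rwa [inv_inv', ← mul_assoc, mul_inv_mul]⟩
  let B : UltrafilterSpace S := ⟨translate a⁻¹ F.1, hact.ultra F.2⟩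
  have hb : b ∈ B.1 := by
    change a⁻¹⁻¹ * b ∈ F.1
    rwa [inv_inv']
  have hdom : filterDom B.1 = filterDom F.1 := by
    refine (congrArg Subtype.val (eq_of_subset (F := dom B) (F' := dom F) ?_))
    rintro x ⟨_, ⟨y, hy, z, hz, rfl⟩, hx⟩
    have hy' : a * y⁻¹ ∈ F.1 := by
      have : a⁻¹⁻¹ * y⁻¹ ∈ F.1 := hy
      rwa [inv_inv'] at this
    have hz' : a * z ∈ F.1 := by
      have : a⁻¹⁻¹ * z ∈ F.1 := hz
      rwa [inv_inv'] at this
    refine ⟨(a * y⁻¹)⁻¹ * (a * z), Set.mul_mem_mul (inv_mem_set_inv hy') hz', ?_⟩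
    refine le_trans ?_ hx
    rw [mul_inv_rev', inv_inv', mul_assoc, ← mul_assoc a⁻¹]
    exact mul_le_mul_left' (inv_mul_mul_le a z) y
  have hc : Composable F B⁻¹ := hdom.symm.trans (filterRan_inv B.1).symm
  refine ⟨mul F B⁻¹ hc, B, ?_, ?_, hb, ?_⟩
  · exact (filterDom_up_mul B.2.prop.inv hc).trans (filterDom_inv B.1)
  · refine ⟨a * b * b⁻¹, Set.mul_mem_mul h ?_, ?_⟩
    · change b⁻¹⁻¹ ∈ B.1
      rwa [inv_inv']
    · rw [mul_assoc]
      exact mul_idem_le a (idem_mul_inv b)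
  · refine Subtype.ext ?_
    change up (up (F.1 * B.1⁻¹) * B.1) = F.1
    rw [up_mul_up_left, mul_assoc, ← up_mul_up_right]
    change up (F.1 * filterDom B.1) = F.1
    rw [hdom, filterDom, up_mul_up_right, ← mul_assoc, F.2.prop.up_mul_inv_mul]

end Up

/-! ### Algebra of groupoids -/

namespace SetGroupoid

variable {G : Type u} [SetGroupoid G]

theorem mul_congr {x x' y y' : G} (hx : x = x') (hy : y = y') (h : Composable x y)
    (h' : Composable x' y') : mul x y h = mul x' y' h' := by
  subst hx hy; rfl

theorem inv_inj {x y : G} (h : x⁻¹ = y⁻¹) : x = y := by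
  rw [← SetGroupoid.inv_inv x, h, SetGroupoid.inv_inv]

theorem dom_inv (x : G) : dom x⁻¹ = ran x := by
  rw [← ran_inv, SetGroupoid.inv_inv]

theorem mul_right_cancel' {x x' y : G} {h : Composable x y} {h' : Composable x' y}
    (e : mul x y h = mul x' y h') : x = x' := by
  obtain ⟨k, hk⟩ := SetGroupoid.mul_inv_cancel x y h
  obtain ⟨k', hk'⟩ := SetGroupoid.mul_inv_cancel x' y h'
  rw [← hk, ← hk']
  exact mul_congr e rfl _ _

theorem mul_inv_mul_cancel {z y : G} (h : Composable z y⁻¹) :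
    ∃ h' : Composable (mul z y⁻¹ h) y, mul (mul z y⁻¹ h) y h' = z := by
  obtain ⟨k, e⟩ := SetGroupoid.mul_inv_cancel z y⁻¹ h
  have k' := k
  rw [SetGroupoid.inv_inv] at k'
  exact ⟨k', (mul_congr rfl (SetGroupoid.inv_inv y).symm _ _).trans e⟩

theorem ran_mul_self (x : G) : ∃ h : Composable (ran x) x, mul (ran x) x h = x := by
  obtain ⟨h, h', e⟩ := assoc x x⁻¹ x (composable_self_inv x) (composable_inv_self x)
  obtain ⟨k, hk⟩ := mul_dom x
  exact ⟨h, e.trans hk⟩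

/-- The product `xy` is defined exactly when `d(x) = r(y)`. -/
theorem composable_iff {x y : G} : Composable x y ↔ dom x = ran y := by
  constructor
  · intro h
    obtain ⟨h1, h2, e⟩ := assoc x⁻¹ x y (composable_inv_self x) h
    obtain ⟨h3, e3⟩ := SetGroupoid.inv_mul_cancel x y h
    obtain ⟨h4, e4⟩ := ran_mul_self y
    exact mul_right_cancel' (e.trans (e3.trans e4.symm))
  · intro h
    obtain ⟨h1, e1⟩ := mul_dom x
    obtain ⟨h2, -⟩ := ran_mul_self y
    rw [← h] at h2
    obtain ⟨h3, -⟩ := assoc _ _ _ h1 h2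
    rwa [e1] at h3

theorem dom_mul {x y : G} (h : Composable x y) : dom (mul x y h) = dom y := by
  obtain ⟨h', -⟩ := SetGroupoid.mul_inv_cancel x y h
  rw [composable_iff.1 h', ran_inv]

theorem ran_mul {x y : G} (h : Composable x y) : ran (mul x y h) = ran x := by
  obtain ⟨h', -⟩ := SetGroupoid.inv_mul_cancel x y h
  rw [← composable_iff.1 h', dom_inv]

theorem dom_of_mem_units {e : G} (he : e ∈ units G) : dom e = e := by
  obtain ⟨x, rfl⟩ := he
  exact (dom_mul (composable_self_inv x)).trans (dom_inv x)

theorem ran_of_mem_units {e : G} (he : e ∈ units G) : ran e = e := by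
  obtain ⟨x, rfl⟩ := he
  exact ran_mul (composable_self_inv x)

theorem mul_unit {x e : G} (he : e ∈ units G) (h : Composable x e) : mul x e h = x := by
  obtain ⟨h1, e1⟩ := mul_dom x
  refine (mul_congr rfl ?_ _ _).trans e1
  rw [composable_iff.1 h, ran_of_mem_units he]

theorem unit_mul {x e : G} (he : e ∈ units G) (h : Composable e x) : mul e x h = x := by
  obtain ⟨h1, e1⟩ := ran_mul_self x
  refine (mul_congr ?_ rfl _ _).trans e1
  rw [← composable_iff.1 h, dom_of_mem_units he]

theorem inv_mul_mem_units {x y : G} (hxy : x = y) (h : Composable x⁻¹ y) :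
    mul x⁻¹ y h ∈ units G := by
  subst hxy; exact dom_mem_units x

theorem mul_inv_mem_units {x y : G} (hxy : x = y) (h : Composable x y⁻¹) :
    mul x y⁻¹ h ∈ units G := by
  subst hxy; exact ⟨x, rfl⟩

theorem eq_of_mul_inv_mem_units {x y : G} {h : Composable x y⁻¹} (he : mul x y⁻¹ h ∈ units G) :
    x = y := by
  obtain ⟨k, hk⟩ := SetGroupoid.mul_inv_cancel x y⁻¹ h
  have hu := unit_mul he k
  rw [hu] at hk
  rw [← hk, SetGroupoid.inv_inv]

theorem eq_of_inv_mul_mem_units {x y : G} {h : Composable x⁻¹ y} (he : mul x⁻¹ y h ∈ units G) :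
    x = y := by
  obtain ⟨k, hk⟩ := SetGroupoid.inv_mul_cancel x⁻¹ y h
  have hu := mul_unit he k
  rw [hu] at hk
  rw [← hk, SetGroupoid.inv_inv]

/-- A bisection is a set on which both `d` and `r` are injective. -/
theorem isBisection_iff {A : Set G} :
    IsBisection A ↔ Set.InjOn dom A ∧ Set.InjOn ran A := by
  constructor
  · rintro ⟨h1, h2⟩
    refine ⟨fun x hx y hy h => ?_, fun x hx y hy h => ?_⟩
    · exact eq_of_mul_inv_mem_units (h2 x hx y hy (composable_iff.2 (by rw [h, ran_inv])))
    · exact eq_of_inv_mul_mem_units (h1 x hx y hy (composable_iff.2 (by rw [dom_inv, h])))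
  · rintro ⟨h1, h2⟩
    refine ⟨fun x hx y hy h => ?_, fun x hx y hy h => ?_⟩
    · exact inv_mul_mem_units (h2 hx hy (by rw [← composable_iff.1 h, dom_inv])) h
    · exact mul_inv_mem_units (h1 hx hy (by rw [composable_iff.1 h, ran_inv])) h

theorem _root_.NCStone.ProperCoveringFunctor.map_inv {H : Type u} [SetGroupoid H]
    [TopologicalSpace G] [TopologicalSpace H] (f : ProperCoveringFunctor G H) (x : G) :
    f.toFun x⁻¹ = (f.toFun x)⁻¹ := by
  obtain ⟨h, e⟩ := f.map_mul _ _ (composable_inv_self x)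
  refine mul_right_cancel' (h := h) (h' := composable_inv_self _) (e.symm.trans ?_)
  exact f.map_dom x

theorem IsBisection.mono {A B : Set G} (hB : IsBisection B)
    (h : A ⊆ B) : IsBisection A :=
  ⟨fun x hx y hy => hB.1 x (h hx) y (h hy), fun x hx y hy => hB.2 x (h hx) y (h hy)⟩

/-- The product `AB` of two sets of arrows. -/
def mulSet (A B : Set G) : Set G := {z | ∃ x ∈ A, ∃ y ∈ B, ∃ h : Composable x y, mul x y h = z}

theorem mulSet_assoc (A B C : Set G) : mulSet (mulSet A B) C = mulSet A (mulSet B C) := by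
  ext z
  constructor
  · rintro ⟨_, ⟨x, hx, y, hy, h, rfl⟩, w, hw, h', rfl⟩
    have hyw : Composable y w := composable_iff.2 (by rw [← composable_iff.1 h', dom_mul])
    obtain ⟨_, h2, e⟩ := assoc x y w h hyw
    exact ⟨x, hx, _, ⟨y, hy, w, hw, hyw, rfl⟩, h2, e.symm⟩
  · rintro ⟨x, hx, _, ⟨y, hy, w, hw, hyw, rfl⟩, h', rfl⟩
    have h : Composable x y := composable_iff.2 (by rw [composable_iff.1 h', ran_mul])
    obtain ⟨h1, _, e⟩ := assoc x y w h hyw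
    exact ⟨_, ⟨x, hx, y, hy, h, rfl⟩, w, hw, h1, e⟩

theorem mulSet_of_subset_units {A E : Set G} (hE : E ⊆ units G) :
    mulSet A E = {x ∈ A | dom x ∈ E} := by
  ext z
  constructor
  · rintro ⟨x, hx, e, he, h, rfl⟩
    rw [mul_unit (hE he) h]
    exact ⟨hx, by rwa [composable_iff.1 h, ran_of_mem_units (hE he)]⟩
  · rintro ⟨hz, hd⟩
    obtain ⟨h, e⟩ := mul_dom z
    exact ⟨z, hz, _, hd, h, e⟩

theorem mulSet_inv_self {A : Set G} (hA : IsBisection A) : mulSet A⁻¹ A = dom '' A := by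
  ext z
  constructor
  · rintro ⟨x, hx, y, hy, h, rfl⟩
    have : x⁻¹ = y := (isBisection_iff.1 hA).2 hx hy (by rw [ran_inv, composable_iff.1 h])
    subst this
    refine ⟨x⁻¹, hy, mul_congr (SetGroupoid.inv_inv x) rfl _ _⟩
  · rintro ⟨x, hx, rfl⟩
    exact ⟨x⁻¹, by rwa [Set.mem_inv, SetGroupoid.inv_inv], x, hx, composable_inv_self x, rfl⟩

theorem IsBisection.inv {A : Set G} (hA : IsBisection A) : IsBisection A⁻¹ := by
  rw [isBisection_iff] at *
  refine ⟨fun x hx y hy h => inv_inj (hA.2 hx hy ?_), fun x hx y hy h => inv_inj (hA.1 hx hy ?_)⟩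
  · rw [ran_inv, ran_inv, h]
  · rw [dom_inv, dom_inv, h]

theorem IsBisection.mulSet {A B : Set G} (hA : IsBisection A) (hB : IsBisection B) :
    IsBisection (mulSet A B) := by
  rw [isBisection_iff] at *
  constructor
  · rintro _ ⟨x, hx, y, hy, h, rfl⟩ _ ⟨x', hx', y', hy', h', rfl⟩ e
    rw [dom_mul, dom_mul] at e
    have e1 := hB.1 hy hy' e
    subst e1
    have e2 := hA.1 hx hx' (by rw [composable_iff.1 h, composable_iff.1 h'])
    subst e2
    rfl
  · rintro _ ⟨x, hx, y, hy, h, rfl⟩ _ ⟨x', hx', y', hy', h', rfl⟩ e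
    rw [ran_mul, ran_mul] at e
    have e1 := hA.2 hx hx' e
    subst e1
    have e2 := hB.2 hy hy' (by rw [← composable_iff.1 h, ← composable_iff.1 h'])
    subst e2
    rfl

end SetGroupoid

/-! ### Prime filters and ultrafilters of boolean inverse semigroups -/

section Boolean

variable {S : Type u} [InverseSemigroupWithZero S]

theorem eq_zero_of_le_zero {a : S} (h : a ≤ 0) : a = 0 := le_antisymm h (zero_le' a)

theorem eq_zero_of_inv_mul_le_zero {a : S} (h : a⁻¹ * a ≤ 0) : a = 0 := by
  rw [← mul_inv_mul a, mul_assoc, eq_zero_of_le_zero h, mul_zero]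

/-- Every non-zero element belongs to an ultrafilter: its up-set is a proper filter, and Zorn's
lemma applies. -/
theorem exists_ultra_mem {a : S} (ha : a ≠ 0) : ∃ F : UltrafilterSpace S, a ∈ F.1 := by
  have h0 : IsProperFilter (Set.Ici a) :=
    ⟨⟨a, Set.mem_Ici.2 le_rfl⟩, fun x y hx hxy => le_trans hx hxy,
      fun x y hx hy => ⟨a, Set.mem_Ici.2 le_rfl, hx, hy⟩,
      fun h => ha (eq_zero_of_le_zero h)⟩
  obtain ⟨F, hle, hF⟩ := zorn_subset_nonempty {F : Set S | IsProperFilter F} (fun c hc hch hne => by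
    refine ⟨⋃₀ c, ⟨?_, ?_, ?_, ?_⟩, fun s hs => Set.subset_sUnion_of_mem hs⟩
    · obtain ⟨s, hs⟩ := hne
      obtain ⟨x, hx⟩ := (hc hs).nonempty
      exact ⟨x, s, hs, hx⟩
    · rintro x y ⟨s, hs, hx⟩ hxy
      exact ⟨s, hs, (hc hs).upward _ _ hx hxy⟩
    · rintro x y ⟨s, hs, hx⟩ ⟨t, ht, hy⟩
      rcases hch.total hs ht with h | h
      · obtain ⟨z, hz, h1, h2⟩ := (hc ht).directed x y (h hx) hy
        exact ⟨z, ⟨t, ht, hz⟩, h1, h2⟩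
      · obtain ⟨z, hz, h1, h2⟩ := (hc hs).directed x y hx (h hy)
        exact ⟨z, ⟨s, hs, hz⟩, h1, h2⟩
    · rintro ⟨s, hs, hx⟩
      exact (hc hs).proper hx) _ h0
  exact ⟨⟨F, hF⟩, hle (Set.mem_Ici.2 le_rfl)⟩

/-- An element outside an ultrafilter is disjoint from some element of the ultrafilter. -/
theorem IsUltra.exists_disjoint (hS : IsBoolean S) {F : Set S} (hF : IsUltra F) {a : S}
    (ha : a ∉ F) : ∃ b ∈ F, ∀ x, x ≤ a → x ≤ b → x = 0 := by
  by_contra! hcon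
  refine ha ?_
  have hC : IsProperFilter {x : S | ∃ b ∈ F, ∀ m, IsGLB {a, b} m → m ≤ x} := by
    refine ⟨?_, ?_, ?_, ?_⟩
    · obtain ⟨b, hb⟩ := hF.prop.nonempty
      exact ⟨a, b, hb, fun m hm => hm.1 (by simp)⟩
    · rintro x y ⟨b, hb, h⟩ hxy
      exact ⟨b, hb, fun m hm => (h m hm).trans hxy⟩
    · rintro x y ⟨b, hb, h⟩ ⟨c, hc, h'⟩
      obtain ⟨d, hd, hdb, hdc⟩ := hF.prop.directed _ _ hb hc
      obtain ⟨m, hm⟩ := hS.exists_meet a d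
      have key : ∀ {b}, d ≤ b → ∀ {m'}, IsGLB {a, b} m' → m ≤ m' := by
        intro b hdb m' hm'
        refine hm'.2 ?_
        rintro _ (rfl | rfl)
        · exact hm.1 (by simp)
        · exact (hm.1 (by simp)).trans hdb
      obtain ⟨m1, hm1⟩ := hS.exists_meet a b
      obtain ⟨m2, hm2⟩ := hS.exists_meet a c
      exact ⟨m, ⟨d, hd, fun m' hm' => (hm'.unique hm).le⟩,
        (key hdb hm1).trans (h _ hm1), (key hdc hm2).trans (h' _ hm2)⟩
    · rintro ⟨b, hb, h⟩
      obtain ⟨m, hm⟩ := hS.exists_meet a b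
      obtain ⟨x, hxa, hxb, hx0⟩ := hcon b hb
      refine hx0 (eq_zero_of_le_zero (le_trans (hm.2 ?_) (h m hm)))
      rintro _ (rfl | rfl)
      exacts [hxa, hxb]
  have hsub : F ⊆ {x : S | ∃ b ∈ F, ∀ m, IsGLB {a, b} m → m ≤ x} :=
    fun b hb => ⟨b, hb, fun m hm => hm.1 (by simp)⟩
  obtain ⟨b, hb⟩ := hF.prop.nonempty
  exact hF.le_of_ge hC hsub ⟨b, hb, fun m hm => hm.1 (by simp)⟩

theorem IsProperFilter.exists_lower_bound {F : Set S} (hF : IsProperFilter F) {A : Set S}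
    (hA : A.Finite) (b : S → S) (hb : ∀ a ∈ A, b a ∈ F) {c : S} (hc : c ∈ F) :
    ∃ z ∈ F, z ≤ c ∧ ∀ a ∈ A, z ≤ b a := by
  induction A, hA using Set.Finite.induction_on with
  | empty => exact ⟨c, hc, le_rfl, fun a ha => ha.elim⟩
  | @insert a A _ _ ih =>
    obtain ⟨z, hz, hzc, h⟩ := ih fun a ha => hb a (Set.mem_insert_of_mem _ ha)
    obtain ⟨w, hw, hwz, hwb⟩ := hF.directed _ _ hz (hb a (Set.mem_insert _ _))
    refine ⟨w, hw, hwz.trans hzc, ?_⟩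
    rintro x (rfl | hx)
    exacts [hwb, hwz.trans (h x hx)]

/-- Ultrafilters are prime with respect to arbitrary finite joins. -/
theorem IsUltra.exists_mem_of_isLUB (hS : IsBoolean S) {F : Set S} (hF : IsUltra F) {A : Set S}
    (hA : A.Finite) {c : S} (h : IsLUB A c) (hc : c ∈ F) : ∃ a ∈ A, a ∈ F := by
  by_contra! hcon
  choose! b hb hdisj using fun a (ha : a ∈ A) => hF.exists_disjoint hS (hcon a ha)
  obtain ⟨z, hz, hzc, hzb⟩ := hF.prop.exists_lower_bound hA b hb hc
  -- `z = c z⁻¹ z` is the join of the elements `a z⁻¹ z`, each below both `a` and `z ≤ b a`.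
  have hlub := hS.join_mul A c (z⁻¹ * z) hA h
  rw [← (le_def z c).1 hzc] at hlub
  refine hF.prop.proper ?_
  have : z ≤ 0 := hlub.2 (by
    rintro _ ⟨a, ha, rfl⟩
    refine (hdisj a ha _ (mul_idem_le a (idem_inv_mul z)) (le_trans ?_ (hzb a ha))).le
    have := mul_le_mul_right' (h.1 ha) (z⁻¹ * z)
    rwa [← (le_def z c).1 hzc] at this)
  rwa [eq_zero_of_le_zero this] at hz

theorem IsUltra.prime (hS : IsBoolean S) {F : Set S} (hF : IsUltra F) : IsPrimeFilter F where
  toIsProperFilter := hF.prop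
  prime a b c h hc := by
    obtain ⟨x, rfl | rfl, hx'⟩ := hF.exists_mem_of_isLUB hS (Set.toFinite {a, b}) h hc
    exacts [Or.inl hx', Or.inr hx']

/-- Relative complements: if `c ≤ p` then `p = c ∨ x` for some `x` disjoint from `c`. -/
theorem IsWeaklyBoolean.exists_diff (hS : IsWeaklyBoolean S) {c p : S} (h : c ≤ p) :
    ∃ x, IsLUB {c, x} p ∧ ∀ y, y ≤ c → y ≤ x → y = 0 := by
  obtain ⟨g, hg, hcg, hlub⟩ := hS.exists_compl (c⁻¹ * c) (p⁻¹ * p) (idem_inv_mul c)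
    (idem_inv_mul p) (inv_mul_le h)
  refine ⟨p * g, ?_, fun y hyc hyx => ?_⟩
  · have := hS.mul_join _ _ p (Set.toFinite _) hlub
    rwa [Set.image_pair, ← (le_def c p).1 h, ← mul_assoc, mul_inv_mul] at this
  · refine eq_zero_of_inv_mul_le_zero ?_
    rw [← hcg]
    refine le_idem_mul (idem_inv_mul c) (inv_mul_le hyc) ((inv_mul_le hyx).trans ?_)
    rw [mul_idem_inv p hg, mul_assoc, ← mul_assoc p⁻¹]
    refine (mul_le_mul_left' (inv_mul_mul_le p g) g).trans ?_
    rw [hg]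

theorem IsPrimeFilter.ultra (hS : IsWeaklyBoolean S) {P : Set S} (hP : IsPrimeFilter P) :
    IsUltra P := by
  refine ⟨hP.toIsProperFilter, fun F hF hle a ha => ?_⟩
  obtain ⟨p, hp⟩ := hP.nonempty
  obtain ⟨c, hc, hca, hcp⟩ := hF.directed _ _ ha (hle hp)
  obtain ⟨x, hx, hdisj⟩ := hS.exists_diff hcp
  rcases hP.prime _ _ _ hx hp with h | h
  · exact hP.upward _ _ h hca
  · obtain ⟨z, hz, hzc, hzx⟩ := hF.directed _ _ hc (hle h)
    rw [hdisj z hzc hzx] at hz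
    exact (hF.proper hz).elim

/-- The basic open set of the ultrafilters that contain `s`. -/
def basicOpen (s : S) : Set (UltrafilterSpace S) := {F | s ∈ F.1}

theorem mem_basicOpen {s : S} {F : UltrafilterSpace S} : F ∈ basicOpen s ↔ s ∈ F.1 := Iff.rfl

theorem isOpen_basicOpen (s : S) : IsOpen (basicOpen s) :=
  isOpen_generateFrom_of_mem ⟨s, rfl⟩

theorem basicOpen_mono {a b : S} (h : a ≤ b) : basicOpen a ⊆ basicOpen b :=
  fun F hF => F.2.prop.upward _ _ hF h

theorem exists_basicOpen_subset {U : Set (UltrafilterSpace S)} (hU : IsOpen U)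
    {F : UltrafilterSpace S} (hF : F ∈ U) : ∃ s ∈ F.1, basicOpen s ⊆ U := by
  obtain ⟨_, ⟨s, rfl⟩, hs, hsU⟩ :=
    (UltrafilterSpace.isTopologicalBasis S).exists_subset_of_mem_open hF hU
  exact ⟨s, hs, hsU⟩

/-- Ultrafilters separate the elements of a boolean inverse semigroup. -/
theorem le_of_basicOpen_subset (hS : IsBoolean S) {a b : S} (h : basicOpen a ⊆ basicOpen b) :
    a ≤ b := by
  obtain ⟨m, hm⟩ := hS.exists_meet a b
  have hma : m ≤ a := hm.1 (by simp)
  have hmb : m ≤ b := hm.1 (by simp)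
  obtain ⟨x, hx, hdisj⟩ := hS.exists_diff hma
  have hxa : x ≤ a := hx.1 (by simp)
  have hx0 : x = 0 := by
    by_contra hx0
    obtain ⟨F, hF⟩ := exists_ultra_mem hx0
    have hbF : b ∈ F.1 := h (F.2.prop.upward _ _ hF hxa)
    obtain ⟨z, hz, hzx, hzb⟩ := F.2.prop.directed _ _ hF hbF
    refine F.2.prop.proper ?_
    rwa [hdisj z (hm.2 ?_) hzx] at hz
    rintro _ (rfl | rfl)
    exacts [hzx.trans hxa, hzb]
  refine (hx.2 ?_ : a ≤ m).trans hmb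
  rintro _ (rfl | rfl)
  exacts [le_rfl, hx0 ▸ zero_le' m]

theorem basicOpen_injective (hS : IsBoolean S) : Function.Injective (basicOpen (S := S)) :=
  fun _ _ h => le_antisymm (le_of_basicOpen_subset hS h.subset)
    (le_of_basicOpen_subset hS h.symm.subset)

theorem basicOpen_isLUB (hS : IsBoolean S) {A : Set S} (hA : A.Finite) {c : S} (h : IsLUB A c) :
    basicOpen c = ⋃ a ∈ A, basicOpen a := by
  refine Set.Subset.antisymm (fun F hF => ?_)
    (Set.iUnion₂_subset fun a ha => basicOpen_mono (h.1 ha))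
  simpa [mem_basicOpen] using F.2.exists_mem_of_isLUB hS hA h hF

/-- The set `{F | s ∈ F}` is compact: for an ultrafilter `𝒰` on the space that contains it, the
elements `t` with `{F | t ∈ F} ∈ 𝒰` form a prime filter of `S`, and `𝒰` converges to it. -/
theorem isCompact_basicOpen (hS : IsBoolean S) (s : S) : IsCompact (basicOpen s) := by
  rw [isCompact_iff_ultrafilter_le_nhds]
  intro 𝒰 h𝒰
  have hs : basicOpen s ∈ 𝒰 := Filter.le_principal_iff.1 h𝒰
  have hP : IsPrimeFilter {t : S | basicOpen t ∈ 𝒰} := by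
    refine ⟨⟨⟨s, hs⟩, fun a b ha hab => Filter.mem_of_superset ha (basicOpen_mono hab),
      fun a b ha hb => ?_, fun h => ?_⟩, fun a b c h hc => ?_⟩
    · obtain ⟨m, hm⟩ := hS.exists_meet a b
      refine ⟨m, Filter.mem_of_superset (Filter.inter_mem ha hb) ?_, hm.1 (by simp),
        hm.1 (by simp)⟩
      rintro F ⟨hFa, hFb⟩
      obtain ⟨z, hz, hza, hzb⟩ := F.2.prop.directed _ _ hFa hFb
      refine F.2.prop.upward _ _ hz (hm.2 ?_)
      rintro _ (rfl | rfl)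
      exacts [hza, hzb]
    · obtain ⟨F, hF⟩ := 𝒰.nonempty_of_mem h
      exact F.2.prop.proper hF
    · rw [Set.mem_ofPred_eq, basicOpen_isLUB hS (Set.toFinite _) h, Set.biUnion_pair] at hc
      exact Ultrafilter.union_mem_iff.1 hc
  refine ⟨⟨_, hP.ultra hS.toIsWeaklyBoolean⟩, hs, ?_⟩
  intro V hV
  obtain ⟨U, hUV, hU, hFU⟩ := mem_nhds_iff.1 hV
  obtain ⟨t, ht, htU⟩ := exists_basicOpen_subset hU hFU
  exact Filter.mem_of_superset ht (htU.trans hUV)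

theorem UltrafilterSpace.t2Space (hS : IsBoolean S) : T2Space (UltrafilterSpace S) := by
  refine ⟨fun A B hAB => ?_⟩
  obtain ⟨a, ha, hb⟩ : ∃ a ∈ A.1, a ∉ B.1 := by
    by_contra! hcon
    exact hAB (UltrafilterSpace.eq_of_subset hcon)
  obtain ⟨b, hbB, hdisj⟩ := B.2.exists_disjoint hS hb
  refine ⟨_, _, isOpen_basicOpen a, isOpen_basicOpen b, ha, hbB, ?_⟩
  refine Set.disjoint_left.2 fun F hFa hFb => ?_
  obtain ⟨z, hz, hza, hzb⟩ := F.2.prop.directed _ _ hFa hFb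
  rw [hdisj z hza hzb] at hz
  exact F.2.prop.proper hz

/-! ### The groupoid of ultrafilters is boolean -/

theorem UltrafilterSpace.isTopologicalGroupoid : IsTopologicalGroupoid (UltrafilterSpace S) where
  continuous_mul := by
    refine continuous_generateFrom_iff.2 ?_
    rintro _ ⟨s, rfl⟩
    refine isOpen_iff_mem_nhds.2 ?_
    rintro ⟨⟨A, B⟩, h⟩ ⟨_, ⟨a, ha, b, hb, rfl⟩, hs⟩
    have hopen : IsOpen (basicOpen a ×ˢ basicOpen b) :=
      (isOpen_basicOpen a).prod (isOpen_basicOpen b)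
    refine Filter.mem_of_superset ((hopen.preimage continuous_subtype_val).mem_nhds
      ⟨ha, hb⟩) ?_
    rintro ⟨⟨A', B'⟩, h'⟩ ⟨ha', hb'⟩
    exact ⟨_, Set.mul_mem_mul ha' hb', hs⟩
  continuous_inv := by
    refine continuous_generateFrom_iff.2 ?_
    rintro _ ⟨s, rfl⟩
    exact isOpen_basicOpen s⁻¹

theorem UltrafilterSpace.isEtale : IsEtale (UltrafilterSpace S) where
  toIsTopologicalGroupoid := UltrafilterSpace.isTopologicalGroupoid
  isLocalHomeomorph_dom := by
    have hcont : Continuous (domMap : UltrafilterSpace S → units (UltrafilterSpace S)) := by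
      refine Continuous.subtype_mk ?_ _
      have : Continuous fun F : UltrafilterSpace S =>
          (⟨(F⁻¹, F), composable_inv_self F⟩ :
            {p : UltrafilterSpace S × UltrafilterSpace S // Composable p.1 p.2}) :=
        (UltrafilterSpace.isTopologicalGroupoid.continuous_inv.prodMk continuous_id).subtype_mk _
      exact UltrafilterSpace.isTopologicalGroupoid.continuous_mul.comp this
    have himg : ∀ s : S, domMap '' basicOpen s = Subtype.val ⁻¹' basicOpen (s⁻¹ * s) := by
      intro s
      ext E
      constructor
      · rintro ⟨F, hF, rfl⟩
        exact mem_filterDom_of_mem hF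
      · intro hE
        obtain ⟨F, hs, hd⟩ := exists_ultra_of_mem_units E.2 hE
        exact ⟨F, hs, Subtype.ext (Subtype.ext hd)⟩
    have hopen : IsOpenMap (domMap : UltrafilterSpace S → units (UltrafilterSpace S)) := by
      rw [(UltrafilterSpace.isTopologicalBasis S).isOpenMap_iff]
      rintro _ ⟨s, rfl⟩
      have := himg s
      rw [basicOpen] at this
      rw [this]
      exact (isOpen_basicOpen _).preimage continuous_subtype_val
    rw [isLocalHomeomorph_iff_isOpenEmbedding_restrict]
    intro F
    obtain ⟨s, hs⟩ := F.2.prop.nonempty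
    refine ⟨basicOpen s, (isOpen_basicOpen s).mem_nhds hs, ?_⟩
    refine .of_continuous_injective_isOpenMap (hcont.comp continuous_subtype_val) ?_
      (hopen.domRestrict (isOpen_basicOpen s))
    rintro ⟨A, hA⟩ ⟨B, hB⟩ h
    exact Subtype.ext (UltrafilterSpace.eq_of_dom_eq
      (congrArg (fun E : units (UltrafilterSpace S) => E.1.1) h) hA hB)

theorem isBisection_basicOpen (s : S) : IsBisection (basicOpen s) := by
  refine ⟨fun A hA B hB h => ?_, fun A hA B hB h => ?_⟩
  · exact UltrafilterSpace.mem_units_iff.2 ⟨s⁻¹ * s,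
      subset_up _ (Set.mul_mem_mul (inv_mem_set_inv hA) hB), idem_inv_mul s⟩
  · exact UltrafilterSpace.mem_units_iff.2 ⟨s * s⁻¹,
      subset_up _ (Set.mul_mem_mul hA (inv_mem_set_inv hB)), idem_mul_inv s⟩

theorem basicOpen_mul (a b : S) :
    basicOpen (a * b) = mulSet (basicOpen a) (basicOpen b) := by
  ext F
  constructor
  · intro hF
    obtain ⟨A, B, hc, ha, hb, h⟩ := UltrafilterSpace.exists_mul_of_mul_mem hF
    exact ⟨A, ha, B, hb, hc, h⟩
  · rintro ⟨A, hA, B, hB, hc, rfl⟩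
    exact subset_up _ (Set.mul_mem_mul hA hB)

/-- An element that lies only in ultrafilters containing an idempotent is itself idempotent. -/
theorem idem_of_basicOpen_subset_units (hS : IsBoolean S) {t : S}
    (h : basicOpen t ⊆ units (UltrafilterSpace S)) : t * t = t := by
  refine idem_of_le (idem_inv_mul t) (le_of_basicOpen_subset hS fun F hF => ?_)
  obtain ⟨e, he, hee⟩ := UltrafilterSpace.mem_units_iff.1 (h hF)
  obtain ⟨c, hc, hct, hce⟩ := F.2.prop.directed _ _ hF he
  refine F.2.prop.upward _ _ hc ?_
  have hcc := idem_of_le hee hce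
  have := inv_mul_le hct
  rwa [idem_inv hcc, hcc] at this

/-- The compact-open bisections of the groupoid of ultrafilters are the sets `{F | s ∈ F}`. -/
theorem exists_eq_basicOpen (hS : IsBoolean S) {U : Set (UltrafilterSpace S)} (hc : IsCompact U)
    (ho : IsOpen U) (hb : IsBisection U) : ∃ s, basicOpen s = U := by
  obtain ⟨t, ht⟩ := hc.elim_finite_subcover (fun s : {s : S // basicOpen s ⊆ U} => basicOpen s.1)
    (fun s => isOpen_basicOpen s.1) (fun F hF => by
      obtain ⟨s, hs, hsU⟩ := exists_basicOpen_subset ho hF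
      exact Set.mem_iUnion.2 ⟨⟨s, hsU⟩, hs⟩)
  have hfin : (Subtype.val '' (t : Set {s : S // basicOpen s ⊆ U})).Finite :=
    t.finite_toSet.image _
  have hcompat : IsCompatibleSet (Subtype.val '' (t : Set {s : S // basicOpen s ⊆ U})) := by
    rintro _ ⟨a, -, rfl⟩ _ ⟨b, -, rfl⟩
    constructor
    · refine idem_of_basicOpen_subset_units hS ?_
      rw [basicOpen_mul]
      rintro _ ⟨A, hA, B, hB, h, rfl⟩
      have hAB : A⁻¹ = B := (isBisection_iff.1 hb).2 (a.2 (show A⁻¹ ∈ basicOpen a.1 from hA))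
        (b.2 hB) (by rw [ran_inv, composable_iff.1 h])
      subst hAB
      exact mul_inv_mem_units rfl h
    · refine idem_of_basicOpen_subset_units hS ?_
      rw [basicOpen_mul]
      rintro _ ⟨A, hA, B, hB, h, rfl⟩
      have hAB : B⁻¹ = A := (isBisection_iff.1 hb).1 (b.2 (show B⁻¹ ∈ basicOpen b.1 from hB))
        (a.2 hA) (by rw [dom_inv, composable_iff.1 h])
      subst hAB
      exact inv_mul_mem_units rfl h
  obtain ⟨s, hs⟩ := hS.exists_join _ hfin hcompat
  refine ⟨s, ?_⟩
  rw [basicOpen_isLUB hS hfin hs]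
  refine Set.Subset.antisymm ?_ fun F hF => ?_
  · refine Set.iUnion₂_subset ?_
    rintro _ ⟨a, -, rfl⟩
    exact a.2
  · obtain ⟨a, ha, hFa⟩ := Set.mem_iUnion₂.1 (ht hF)
    exact Set.mem_iUnion₂.2 ⟨a.1, ⟨a, ha, rfl⟩, hFa⟩

end Boolean

/-! ### Topological and boolean groupoids -/

section TopologicalGroupoid

variable {G : Type u} [SetGroupoid G] [TopologicalSpace G]

theorem IsTopologicalGroupoid.continuous_dom (hG : IsTopologicalGroupoid G) :
    Continuous (dom : G → G) :=
  hG.continuous_mul.comp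
    ((hG.continuous_inv.prodMk continuous_id).subtype_mk fun x => composable_inv_self x)

theorem IsTopologicalGroupoid.continuous_ran (hG : IsTopologicalGroupoid G) :
    Continuous (ran : G → G) :=
  hG.continuous_mul.comp
    ((continuous_id.prodMk hG.continuous_inv).subtype_mk fun x => composable_self_inv x)

theorem IsTopologicalGroupoid.isClosed_units [T2Space G] (hG : IsTopologicalGroupoid G) :
    IsClosed (units G) := by
  have : units G = {x | dom x = x} :=
    Set.ext fun x => ⟨dom_of_mem_units, fun h => h ▸ dom_mem_units x⟩
  rw [this]
  exact isClosed_eq hG.continuous_dom continuous_id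

theorem IsTopologicalGroupoid.isCompact_inv (hG : IsTopologicalGroupoid G) {A : Set G}
    (hA : IsCompact A) : IsCompact A⁻¹ := by
  have : A⁻¹ = (fun x => x⁻¹) '' A := by
    ext x
    exact ⟨fun hx => ⟨x⁻¹, hx, SetGroupoid.inv_inv x⟩, by
      rintro ⟨y, hy, rfl⟩; rwa [Set.mem_inv, SetGroupoid.inv_inv]⟩
  rw [this]
  exact hA.image hG.continuous_inv

theorem IsTopologicalGroupoid.isCompact_mulSet [T2Space G] (hG : IsTopologicalGroupoid G)
    {A B : Set G} (hA : IsCompact A) (hB : IsCompact B) : IsCompact (mulSet A B) := by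
  have hclosed : IsClosed {p : G × G | Composable p.1 p.2} := by
    simp only [composable_iff]
    exact isClosed_eq (hG.continuous_dom.comp continuous_fst)
      (hG.continuous_ran.comp continuous_snd)
  have := (hclosed.isClosedEmbedding_subtypeVal.isCompact_preimage (hA.prod hB)).image
    hG.continuous_mul
  convert this using 1
  ext z
  constructor
  · rintro ⟨x, hx, y, hy, h, rfl⟩
    exact ⟨⟨(x, y), h⟩, ⟨hx, hy⟩, rfl⟩
  · rintro ⟨⟨⟨x, y⟩, h⟩, ⟨hx, hy⟩, rfl⟩
    exact ⟨x, hx, y, hy, h, rfl⟩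

/-- In an étale groupoid a product of open sets is open: if `z₀ = x₀ y₀`, then every `z` close to
`z₀` has some `y ∈ B` close to `y₀` with the same domain, since `d` is open, and then
`z y⁻¹` is close to `x₀`. -/
theorem IsEtale.isOpen_mulSet (hG : IsEtale G) {A B : Set G} (hA : IsOpen A) (hB : IsOpen B) :
    IsOpen (mulSet A B) := by
  refine isOpen_iff_mem_nhds.2 ?_
  rintro _ ⟨x₀, hx₀, y₀, hy₀, h₀, rfl⟩
  have hcont : Continuous fun p : {p : G × G // Composable p.1 p.2⁻¹} =>
      mul p.1.1 p.1.2⁻¹ p.2 :=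
    hG.continuous_mul.comp (((continuous_fst.comp continuous_subtype_val).prodMk
      (hG.continuous_inv.comp (continuous_snd.comp continuous_subtype_val))).subtype_mk
      fun p => p.2)
  obtain ⟨W, hW, hWA⟩ := isOpen_induced_iff.1 (hA.preimage hcont)
  obtain ⟨hk, ek⟩ := SetGroupoid.mul_inv_cancel x₀ y₀ h₀
  have hmem : (mul x₀ y₀ h₀, y₀) ∈ W := by
    have : (⟨(mul x₀ y₀ h₀, y₀), hk⟩ : {p : G × G // Composable p.1 p.2⁻¹}) ∈
        Subtype.val ⁻¹' W := by
      rw [hWA]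
      change mul (mul x₀ y₀ h₀) y₀⁻¹ hk ∈ A
      rwa [ek]
    exact this
  obtain ⟨Z, Y, hZ, hY, hz, hy, hZY⟩ := isOpen_prod_iff.1 hW _ _ hmem
  have hd := (hG.isLocalHomeomorph_dom.isOpenMap _ (hY.inter hB)).preimage
    hG.isLocalHomeomorph_dom.continuous
  refine Filter.mem_of_superset ((hZ.inter hd).mem_nhds
    ⟨hz, y₀, ⟨hy, hy₀⟩, Subtype.ext (dom_mul h₀).symm⟩) ?_
  rintro z ⟨hzZ, y, ⟨hyY, hyB⟩, hyz⟩
  have hdom : dom y = dom z := congrArg Subtype.val hyz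
  have hc : Composable z y⁻¹ := composable_iff.2 (by rw [ran_inv, hdom])
  have hzyA : mul z y⁻¹ hc ∈ A := by
    have : (⟨(z, y), hc⟩ : {p : G × G // Composable p.1 p.2⁻¹}) ∈ Subtype.val ⁻¹' W :=
      hZY ⟨hzZ, hyY⟩
    rw [hWA] at this
    exact this
  obtain ⟨h1, e1⟩ := mul_inv_mul_cancel hc
  exact ⟨_, hzyA, y, hyB, h1, e1⟩

/-- The identities of a Hausdorff topological groupoid with a basis of compact-open sets form a
boolean space. -/
theorem IsTopologicalGroupoid.isBooleanSpace_units [T2Space G] (hG : IsTopologicalGroupoid G)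
    {b : Set (Set G)} (hb : IsTopologicalBasis b) (hbc : ∀ U ∈ b, IsCompact U) :
    IsBooleanSpace (units G) := by
  refine ⟨inferInstance, ?_⟩
  refine isTopologicalBasis_of_isOpen_of_nhds (fun U hU => hU.2) fun x V hx hV => ?_
  obtain ⟨W, hW, rfl⟩ := isOpen_induced_iff.1 hV
  obtain ⟨U, hU, hxU, hUW⟩ := hb.exists_subset_of_mem_open (a := x.1) hx hW
  exact ⟨Subtype.val ⁻¹' U,
    ⟨hG.isClosed_units.isClosedEmbedding_subtypeVal.isCompact_preimage (hbc U hU),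
      (hb.isOpen hU).preimage continuous_subtype_val⟩, hxU, Set.preimage_mono hUW⟩

end TopologicalGroupoid

theorem UltrafilterSpace.isBooleanGroupoid {S : Type u} [InverseSemigroupWithZero S]
    (hS : IsBoolean S) : IsBooleanGroupoid (UltrafilterSpace S) where
  toIsEtale := UltrafilterSpace.isEtale
  t2 := UltrafilterSpace.t2Space hS
  basis := by
    refine isTopologicalBasis_of_isOpen_of_nhds (fun U hU => hU.2.1) fun F V hF hV => ?_
    obtain ⟨s, hs, hsV⟩ := exists_basicOpen_subset hV hF
    exact ⟨basicOpen s, ⟨isCompact_basicOpen hS s, isOpen_basicOpen s, isBisection_basicOpen s⟩,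
      hs, hsV⟩
  units_boolean := by
    have := UltrafilterSpace.t2Space hS
    refine UltrafilterSpace.isTopologicalGroupoid.isBooleanSpace_units
      (UltrafilterSpace.isTopologicalBasis S) ?_
    rintro _ ⟨s, rfl⟩
    exact isCompact_basicOpen hS s

/-! ### The boolean inverse semigroup of compact-open bisections -/

instance (G : BooleanGrpd.{u}) : T2Space G := G.isBoolean.t2

/-- The compact-open bisections of a boolean groupoid. -/
def CompactOpenBisection (G : BooleanGrpd.{u}) : Type u :=
  {U : Set G // IsCompact U ∧ IsOpen U ∧ IsBisection U}

namespace CompactOpenBisection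

variable {G : BooleanGrpd.{u}}

theorem ext {A B : CompactOpenBisection G} (h : A.1 = B.1) : A = B := Subtype.ext h

instance : InverseSemigroupWithZero (CompactOpenBisection G) where
  mul A B := ⟨mulSet A.1 B.1,
    G.isBoolean.toIsTopologicalGroupoid.isCompact_mulSet A.2.1 B.2.1,
    G.isBoolean.isOpen_mulSet A.2.2.1 B.2.2.1, A.2.2.2.mulSet B.2.2.2⟩
  mul_assoc A B C := ext (mulSet_assoc A.1 B.1 C.1)
  inv A := ⟨A.1⁻¹, G.isBoolean.toIsTopologicalGroupoid.isCompact_inv A.2.1,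
    A.2.2.1.preimage G.isBoolean.continuous_inv, A.2.2.2.inv⟩
  zero := ⟨∅, isCompact_empty, isOpen_empty, fun _ h => h.elim, fun _ h => h.elim⟩
  zero_mul A := ext (Set.eq_empty_of_forall_notMem fun _ ⟨_, h, _⟩ => h)
  mul_zero A := ext (Set.eq_empty_of_forall_notMem fun _ ⟨_, _, _, h, _⟩ => h)
  mul_inv_mul A := by
    refine ext ?_
    change mulSet (mulSet A.1 A.1⁻¹) A.1 = A.1
    rw [mulSet_assoc, mulSet_inv_self A.2.2.2, mulSet_of_subset_units]
    · exact Set.ext fun x => ⟨fun h => h.1, fun h => ⟨h, x, h, rfl⟩⟩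
    · rintro _ ⟨x, -, rfl⟩
      exact dom_mem_units x
  inv_mul_inv A := by
    refine ext ?_
    have hinv : (A.1⁻¹)⁻¹ = A.1 := Set.ext fun x => by
      rw [Set.mem_inv, Set.mem_inv, SetGroupoid.inv_inv]
    change mulSet (mulSet A.1⁻¹ A.1) A.1⁻¹ = A.1⁻¹
    have h := mulSet_inv_self A.2.2.2.inv
    rw [hinv] at h
    rw [mulSet_assoc, h, mulSet_of_subset_units]
    · exact Set.ext fun x => ⟨fun h => h.1, fun h => ⟨h, x, h, rfl⟩⟩
    · rintro _ ⟨x, -, rfl⟩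
      exact dom_mem_units x
  inv_unique A B h1 h2 := by
    have key : ∀ A B : CompactOpenBisection G, mulSet (mulSet A.1 B.1) A.1 = A.1 →
        ∀ x ∈ A.1, x⁻¹ ∈ B.1 := by
      intro A B h x hx
      rw [← h] at hx
      obtain ⟨y, ⟨x₁, hx₁, b, hb, hc, rfl⟩, x₂, hx₂, hc', rfl⟩ := hx
      -- the outer factors equal the product itself, having the same range and domain
      have hx : mul (mul x₁ b hc) x₂ hc' ∈ A.1 := by
        rw [← h]; exact ⟨_, ⟨x₁, hx₁, b, hb, hc, rfl⟩, x₂, hx₂, hc', rfl⟩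
      have e1 := (isBisection_iff.1 A.2.2.2).2 hx₁ hx (by rw [ran_mul, ran_mul])
      have e2 := (isBisection_iff.1 A.2.2.2).1 hx₂ hx (by rw [dom_mul])
      have e3 : mul (mul x₁ b hc) x₂ hc' = mul (ran x₂) x₂ (ran_mul_self x₂).choose := by
        rw [(ran_mul_self x₂).choose_spec, ← e2]
      have e4 := mul_right_cancel' e3
      have hx12 : x₁ = x₂ := e1.trans e2.symm
      subst hx12
      have hb' : x₁⁻¹ = b := by
        obtain ⟨k, hk⟩ := SetGroupoid.inv_mul_cancel x₁ b hc
        rw [← hk]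
        have hu : mul x₁ b hc ∈ units G := by rw [e4]; exact ⟨x₁, rfl⟩
        exact (mul_unit hu k).symm
      rw [← e1, hb']
      exact hb
    have e1 := key A B (congrArg Subtype.val h1)
    have e2 := key B A (congrArg Subtype.val h2)
    refine ext (Set.Subset.antisymm e2 fun x hx => ?_)
    have := e1 _ hx
    rwa [SetGroupoid.inv_inv] at this

theorem mul_val (A B : CompactOpenBisection G) : (A * B).1 = mulSet A.1 B.1 := rfl

theorem inv_val (A : CompactOpenBisection G) : (A⁻¹).1 = A.1⁻¹ := rfl

theorem inv_mul_val (A : CompactOpenBisection G) : (A⁻¹ * A).1 = dom '' A.1 :=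
  mulSet_inv_self A.2.2.2

/-- The natural partial order is inclusion. -/
theorem le_iff {A B : CompactOpenBisection G} : A ≤ B ↔ A.1 ⊆ B.1 := by
  have h : (B * (A⁻¹ * A)).1 = {x ∈ B.1 | dom x ∈ dom '' A.1} := by
    rw [mul_val, inv_mul_val, mulSet_of_subset_units]
    rintro _ ⟨x, -, rfl⟩
    exact dom_mem_units x
  have h' : A = B * (A⁻¹ * A) ↔ A.1 = (B * (A⁻¹ * A)).1 := ⟨congrArg Subtype.val, ext⟩
  rw [le_def, h', h]
  constructor
  · intro h' x hx
    rw [h'] at hx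
    exact hx.1
  · intro h'
    ext x
    constructor
    · exact fun hx => ⟨h' hx, x, hx, rfl⟩
    · rintro ⟨hx, y, hy, e⟩
      rwa [← (isBisection_iff.1 B.2.2.2).1 (h' hy) hx e]

theorem idem_iff {A : CompactOpenBisection G} : A * A = A ↔ A.1 ⊆ units G := by
  constructor
  · intro h
    have h2 : (A⁻¹ * A).1 = A.1 := by rw [idem_inv h, h]
    rw [inv_mul_val] at h2
    rw [← h2]
    rintro _ ⟨x, -, rfl⟩
    exact dom_mem_units x
  · intro h
    refine ext ?_
    rw [mul_val, mulSet_of_subset_units h]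
    exact Set.ext fun x => ⟨fun h => h.1, fun hx => ⟨hx, by rwa [dom_of_mem_units (h hx)]⟩⟩

theorem isLUB_of_eq_iUnion {𝒜 : Set (CompactOpenBisection G)} {A : CompactOpenBisection G}
    (h : A.1 = ⋃ B ∈ 𝒜, B.1) : IsLUB 𝒜 A := by
  constructor
  · intro B hB
    rw [le_iff, h]
    exact Set.subset_biUnion_of_mem (u := fun B : CompactOpenBisection G => B.1) hB
  · intro C hC
    rw [le_iff, h]
    exact Set.iUnion₂_subset fun B hB => le_iff.1 (hC hB)

theorem exists_eq_iUnion {𝒜 : Set (CompactOpenBisection G)} (h𝒜 : 𝒜.Finite)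
    (hb : IsBisection (⋃ B ∈ 𝒜, B.1)) : ∃ A : CompactOpenBisection G, A.1 = ⋃ B ∈ 𝒜, B.1 :=
  ⟨⟨_, h𝒜.isCompact_biUnion fun B _ => B.2.1, isOpen_biUnion fun B _ => B.2.2.1, hb⟩, rfl⟩

theorem isLUB_iff {𝒜 : Set (CompactOpenBisection G)} (h𝒜 : 𝒜.Finite)
    {A : CompactOpenBisection G} : IsLUB 𝒜 A ↔ A.1 = ⋃ B ∈ 𝒜, B.1 := by
  refine ⟨fun h => ?_, isLUB_of_eq_iUnion⟩
  have hsub : (⋃ B ∈ 𝒜, B.1) ⊆ A.1 := Set.iUnion₂_subset fun B hB => le_iff.1 (h.1 hB)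
  obtain ⟨C, hC⟩ := exists_eq_iUnion h𝒜 (A.2.2.2.mono hsub)
  rw [← hC, h.unique (isLUB_of_eq_iUnion hC)]

theorem isBisection_iUnion {𝒜 : Set (CompactOpenBisection G)} (h : IsCompatibleSet 𝒜) :
    IsBisection (⋃ B ∈ 𝒜, B.1) := by
  constructor
  · intro x hx y hy hc
    obtain ⟨A, hA, hxA⟩ := Set.mem_iUnion₂.1 hx
    obtain ⟨B, hB, hyB⟩ := Set.mem_iUnion₂.1 hy
    refine idem_iff.1 (h A hA B hB).1 ⟨x⁻¹, ?_, y, hyB, hc, rfl⟩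
    rwa [inv_val, Set.mem_inv, SetGroupoid.inv_inv]
  · intro x hx y hy hc
    obtain ⟨A, hA, hxA⟩ := Set.mem_iUnion₂.1 hx
    obtain ⟨B, hB, hyB⟩ := Set.mem_iUnion₂.1 hy
    refine idem_iff.1 (h A hA B hB).2 ⟨x, hxA, y⁻¹, ?_, hc, rfl⟩
    rwa [inv_val, Set.mem_inv, SetGroupoid.inv_inv]

theorem isDistributive : IsDistributive (CompactOpenBisection G) where
  exists_join 𝒜 h𝒜 hc := by
    obtain ⟨A, hA⟩ := exists_eq_iUnion h𝒜 (isBisection_iUnion hc)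
    exact ⟨A, isLUB_of_eq_iUnion hA⟩
  mul_join 𝒜 A B h𝒜 h := by
    rw [isLUB_iff h𝒜] at h
    refine isLUB_of_eq_iUnion ?_
    rw [Set.biUnion_image, mul_val, h]
    ext z
    simp only [Set.mem_iUnion₂]
    constructor
    · rintro ⟨x, hx, y, hy, hc, rfl⟩
      obtain ⟨C, hC, hyC⟩ := Set.mem_iUnion₂.1 hy
      exact ⟨C, hC, x, hx, y, hyC, hc, rfl⟩
    · rintro ⟨C, hC, x, hx, y, hyC, hc, rfl⟩
      exact ⟨x, hx, y, Set.mem_iUnion₂.2 ⟨C, hC, hyC⟩, hc, rfl⟩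
  join_mul 𝒜 A B h𝒜 h := by
    rw [isLUB_iff h𝒜] at h
    refine isLUB_of_eq_iUnion ?_
    rw [Set.biUnion_image, mul_val, h]
    ext z
    simp only [Set.mem_iUnion₂]
    constructor
    · rintro ⟨x, hx, y, hy, hc, rfl⟩
      obtain ⟨C, hC, hxC⟩ := Set.mem_iUnion₂.1 hx
      exact ⟨C, hC, x, hxC, y, hy, hc, rfl⟩
    · rintro ⟨C, hC, x, hxC, y, hy, hc, rfl⟩
      exact ⟨x, Set.mem_iUnion₂.2 ⟨C, hC, hxC⟩, y, hy, hc, rfl⟩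

/-- Differences of compact-open bisections. -/
def diff (A B : CompactOpenBisection G) : CompactOpenBisection G :=
  ⟨A.1 \ B.1, A.2.1.diff B.2.2.1, A.2.2.1.sdiff B.2.1.isClosed,
    A.2.2.2.mono Set.sdiff_subset⟩

/-- Intersections of compact-open bisections. -/
def inter (A B : CompactOpenBisection G) : CompactOpenBisection G :=
  ⟨A.1 ∩ B.1, A.2.1.inter B.2.1, A.2.2.1.inter B.2.2.1, A.2.2.2.mono Set.inter_subset_left⟩

theorem le_inter_iff {A B C : CompactOpenBisection G} : C ≤ inter A B ↔ C ≤ A ∧ C ≤ B := by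
  simp only [le_iff]
  exact Set.subset_inter_iff

theorem isBoolean : IsBoolean (CompactOpenBisection G) where
  toIsDistributive := isDistributive
  exists_compl E F hE hF hEF := by
    have hE' := idem_iff.1 hE
    have hF' := idem_iff.1 hF
    have hsub : (diff F E).1 ⊆ units G := Set.sdiff_subset.trans hF'
    refine ⟨diff F E, idem_iff.2 hsub, ext ?_, (isLUB_iff (Set.toFinite _)).2 ?_⟩
    · rw [mul_val, mulSet_of_subset_units hsub]
      refine Set.eq_empty_of_forall_notMem ?_
      rintro x ⟨hx, hx'⟩
      rw [dom_of_mem_units (hE' hx)] at hx'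
      exact hx'.2 hx
    · rw [Set.biUnion_pair]
      exact (Set.union_sdiff_cancel (le_iff.1 hEF)).symm
  exists_meet A B := by
    refine ⟨inter A B, ?_, fun C hC => le_inter_iff.2 ⟨hC (by simp), hC (by simp)⟩⟩
    rintro _ (rfl | rfl)
    exacts [(le_inter_iff.1 le_rfl).1, (le_inter_iff.1 le_rfl).2]

theorem exists_mem_subset {U : Set G} (hU : IsOpen U) {g : G} (hg : g ∈ U) :
    ∃ A : CompactOpenBisection G, g ∈ A.1 ∧ A.1 ⊆ U := by
  obtain ⟨A, hA, hgA, hAU⟩ := G.isBoolean.basis.exists_subset_of_mem_open hg hU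
  exact ⟨⟨A, hA⟩, hgA, hAU⟩

/-! ### Proper covering functors act on compact-open bisections -/

variable {H : BooleanGrpd.{u}}

/-- The inverse image of a compact-open bisection under a proper continuous covering functor. -/
def comap (f : ProperCoveringFunctor G H) (A : CompactOpenBisection H) :
    CompactOpenBisection G :=
  ⟨f.toFun ⁻¹' A.1, f.proper _ A.2.1, A.2.2.1.preimage f.continuous, by
    have hinj : Set.InjOn dom (f.toFun ⁻¹' A.1) := fun x hx y hy h =>
      f.star_inj x y h ((isBisection_iff.1 A.2.2.2).1 hx hy (by
        rw [← f.map_dom, ← f.map_dom, h]))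
    refine isBisection_iff.2 ⟨hinj, fun x hx y hy h => inv_inj ?_⟩
    refine f.star_inj _ _ (by rw [dom_inv, dom_inv, h]) ?_
    rw [f.map_inv, f.map_inv]
    refine congrArg _ ((isBisection_iff.1 A.2.2.2).2 hx hy ?_)
    rw [← dom_inv, ← dom_inv, ← f.map_inv, ← f.map_inv, ← f.map_dom, ← f.map_dom, dom_inv,
      dom_inv, h]⟩

theorem comap_mul (f : ProperCoveringFunctor G H) (A B : CompactOpenBisection H) :
    comap f (A * B) = comap f A * comap f B := by
  refine ext (Set.Subset.antisymm ?_ ?_)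
  · rintro z ⟨a, ha, b, hb, hc, e⟩
    obtain ⟨y, hy, rfl⟩ := f.star_surj (dom z) b (dom_mem_units z) (by
      rw [f.map_dom, ← e, dom_mul])
    have hzy : Composable z y⁻¹ := composable_iff.2 (by rw [ran_inv, hy])
    obtain ⟨h1, e1⟩ := mul_inv_mul_cancel hzy
    obtain ⟨h2, e2⟩ := f.map_mul _ _ h1
    rw [e1, ← e] at e2
    refine ⟨_, ?_, y, hb, h1, e1⟩
    change f.toFun (mul z y⁻¹ hzy) ∈ A.1
    rwa [← mul_right_cancel' e2]
  · rintro _ ⟨x, hx, y, hy, h, rfl⟩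
    obtain ⟨h', e⟩ := f.map_mul _ _ h
    exact ⟨_, hx, _, hy, h', e.symm⟩

/-- Inverse images under a proper continuous covering functor form a callitic morphism. -/
def comapHom (f : ProperCoveringFunctor G H) :
    CalliticHom (CompactOpenBisection H) (CompactOpenBisection G) where
  toFun := comap f
  map_mul := comap_mul f
  map_join 𝒜 A h𝒜 _ h := by
    refine isLUB_of_eq_iUnion ?_
    rw [Set.biUnion_image]
    change f.toFun ⁻¹' A.1 = _
    rw [(isLUB_iff h𝒜).1 h, Set.preimage_iUnion₂]
    rfl
  dc1 A₁ A₂ B h₁ h₂ := by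
    have h := le_inter_iff.1 (le_refl (inter A₁ A₂))
    exact ⟨_, h.1, h.2, le_iff.2 (Set.subset_inter (le_iff.1 h₁) (le_iff.1 h₂))⟩
  dc2 P hP := by
    obtain ⟨B, hB⟩ := hP.nonempty
    obtain ⟨t, ht⟩ := B.2.1.elim_finite_subcover
      (fun A : CompactOpenBisection H => (comap f A).1) (fun A => (comap f A).2.2.1)
      (fun g _ => by
        obtain ⟨A, hA, -⟩ := exists_mem_subset isOpen_univ (Set.mem_univ (f.toFun g))
        exact Set.mem_iUnion.2 ⟨A, hA⟩)
    have hfin : ((fun A => inter B (comap f A)) '' (t : Set (CompactOpenBisection H))).Finite :=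
      t.finite_toSet.image _
    have hlub : IsLUB ((fun A => inter B (comap f A)) '' (t : Set (CompactOpenBisection H))) B := by
      refine isLUB_of_eq_iUnion ?_
      rw [Set.biUnion_image]
      refine Set.Subset.antisymm (fun x hx => ?_)
        (Set.iUnion₂_subset fun A _ => Set.inter_subset_left)
      obtain ⟨A, hA, hxA⟩ := Set.mem_iUnion₂.1 (ht hx)
      exact Set.mem_iUnion₂.2 ⟨A, hA, hx, hxA⟩
    obtain ⟨_, ⟨A, -, rfl⟩, hA⟩ :=
      (hP.ultra isBoolean.toIsWeaklyBoolean).exists_mem_of_isLUB isBoolean hfin hlub hB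
    exact ⟨A, hP.upward _ _ hA (le_inter_iff.1 le_rfl).2⟩

/-! ### Arrows of a boolean groupoid as ultrafilters -/

/-- The compact-open bisections that contain a given arrow form a prime filter. -/
theorem isUltra_point (g : G) : IsUltra {A : CompactOpenBisection G | g ∈ A.1} := by
  refine IsPrimeFilter.ultra isBoolean.toIsWeaklyBoolean ⟨⟨?_, ?_, ?_, ?_⟩, ?_⟩
  · obtain ⟨A, hA, -⟩ := exists_mem_subset isOpen_univ (Set.mem_univ g)
    exact ⟨A, hA⟩
  · exact fun A B hA hAB => le_iff.1 hAB hA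
  · exact fun A B hA hB => ⟨inter A B, ⟨hA, hB⟩, le_inter_iff.1 le_rfl⟩
  · exact fun h => h
  · intro A B C h hC
    rw [isLUB_iff (Set.toFinite _), Set.biUnion_pair] at h
    change g ∈ C.1 at hC
    rwa [h] at hC

/-- The ultrafilter of all compact-open bisections that contain a given arrow. -/
def point (g : G) : UltrafilterSpace (CompactOpenBisection G) := ⟨_, isUltra_point g⟩

theorem mem_point {g : G} {A : CompactOpenBisection G} : A ∈ (point g).1 ↔ g ∈ A.1 := Iff.rfl

theorem point_injective : Function.Injective (point (G := G)) := by
  intro g g' h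
  by_contra hne
  obtain ⟨A, hA, hAU⟩ := exists_mem_subset (isOpen_compl_singleton (x := g')) hne
  have : A ∈ (point g').1 := h ▸ mem_point.2 hA
  exact hAU this rfl

/-- Every ultrafilter of compact-open bisections is a family of compact sets with the finite
intersection property, hence is fixed by an arrow. -/
theorem point_surjective : Function.Surjective (point (G := G)) := by
  intro F
  obtain ⟨A, hA⟩ := F.2.prop.nonempty
  have hne : (⋂ B : F.1, B.1.1).Nonempty := by
    have : Nonempty F.1 := ⟨⟨A, hA⟩⟩
    refine IsCompact.nonempty_iInter_of_directed_nonempty_isCompact_isClosed _ ?_ ?_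
      (fun B => B.1.2.1) (fun B => B.1.2.1.isClosed)
    · intro B C
      obtain ⟨D, hD, hDB, hDC⟩ := F.2.prop.directed _ _ B.2 C.2
      exact ⟨⟨D, hD⟩, le_iff.1 hDB, le_iff.1 hDC⟩
    · intro B
      by_contra hB
      have h0 : B.1 = 0 := ext (Set.not_nonempty_iff_eq_empty.1 hB)
      exact F.2.prop.proper (h0 ▸ B.2)
  obtain ⟨g, hg⟩ := hne
  exact ⟨g, (UltrafilterSpace.eq_of_subset fun B hB => Set.mem_iInter.1 hg ⟨B, hB⟩).symm⟩

/-- A boolean groupoid is homeomorphic to the space of ultrafilters of its compact-open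
bisections. -/
noncomputable def pointHomeomorph (G : BooleanGrpd.{u}) :
    G ≃ₜ UltrafilterSpace (CompactOpenBisection G) :=
  (Equiv.ofBijective point ⟨point_injective, point_surjective⟩).toHomeomorphOfContinuousOpen
    (by
      refine continuous_generateFrom_iff.2 ?_
      rintro _ ⟨A, rfl⟩
      exact A.2.2.1)
    (by
      rw [G.isBoolean.basis.isOpenMap_iff]
      intro U hU
      let A : CompactOpenBisection G := ⟨U, hU⟩
      have : point '' U = basicOpen A := by
        ext F
        obtain ⟨g, rfl⟩ := point_surjective F
        exact point_injective.mem_set_image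
      exact this ▸ isOpen_basicOpen _)

theorem dom_point (g : G) : dom (point g) = point (dom g) := by
  refine UltrafilterSpace.eq_of_subset ?_
  rintro C ⟨_, ⟨A, hA, B, hB, rfl⟩, hC⟩
  have hA' : g⁻¹ ∈ A.1 := hA
  exact le_iff.1 hC ⟨g⁻¹, hA', g, hB, composable_inv_self g, rfl⟩

theorem point_inv (g : G) : point g⁻¹ = (point g)⁻¹ := rfl

theorem composable_point_iff {g h : G} : Composable (point g) (point h) ↔ Composable g h := by
  rw [composable_iff, composable_iff, ← dom_inv, ← point_inv, dom_point, dom_point,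
    point_injective.eq_iff, dom_inv]

theorem point_mul {g h : G} (hc : Composable g h) (hc' : Composable (point g) (point h)) :
    point (mul g h hc) = mul (point g) (point h) hc' := by
  refine (UltrafilterSpace.eq_of_subset ?_).symm
  rintro C ⟨_, ⟨A, hA, B, hB, rfl⟩, hC⟩
  exact le_iff.1 hC ⟨g, hA, h, hB, hc, rfl⟩

end CompactOpenBisection

/-! ### Isomorphisms in the two categories -/

/-- A groupoid isomorphism that is a homeomorphism is a proper covering functor. -/
def ProperCoveringFunctor.ofHomeomorph {G H : Type u} [SetGroupoid G] [TopologicalSpace G]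
    [SetGroupoid H] [TopologicalSpace H] (φ : G ≃ₜ H)
    (hφ : ∀ (x y : G) (h : Composable x y),
      ∃ h' : Composable (φ x) (φ y), φ (mul x y h) = mul (φ x) (φ y) h')
    (hdom : ∀ x, φ (dom x) = dom (φ x)) : ProperCoveringFunctor G H where
  toFun := φ
  map_mul := hφ
  star_inj _ _ _ h := φ.injective h
  star_surj e h _ he := by
    refine ⟨φ.symm h, φ.injective ?_, φ.apply_symm_apply h⟩
    rw [hdom, φ.apply_symm_apply, he]
  continuous := φ.continuous
  proper _ hK := φ.isCompact_preimage.2 hK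

/-- The isomorphism from a boolean groupoid to the groupoid of ultrafilters of its compact-open
bisections. -/
noncomputable def pointIso (G : BooleanGrpd.{u}) :
    G ≅ ⟨UltrafilterSpace (CompactOpenBisection G),
      UltrafilterSpace.isBooleanGroupoid CompactOpenBisection.isBoolean⟩ where
  hom := ProperCoveringFunctor.ofHomeomorph (CompactOpenBisection.pointHomeomorph G)
    (fun _ _ h => ⟨CompactOpenBisection.composable_point_iff.2 h,
      CompactOpenBisection.point_mul h _⟩)
    (fun x => (CompactOpenBisection.dom_point x).symm)
  inv := ProperCoveringFunctor.ofHomeomorph (CompactOpenBisection.pointHomeomorph G).symm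
    (fun x y h => by
      obtain ⟨x, rfl⟩ := (CompactOpenBisection.pointHomeomorph G).surjective x
      obtain ⟨y, rfl⟩ := (CompactOpenBisection.pointHomeomorph G).surjective y
      have hxy : Composable x y := CompactOpenBisection.composable_point_iff.1 h
      have e : CompactOpenBisection.pointHomeomorph G (mul x y hxy) = mul _ _ h :=
        CompactOpenBisection.point_mul hxy h
      rw [← e]
      simp only [Homeomorph.symm_apply_apply]
      exact ⟨hxy, trivial⟩)
    (fun x => by
      obtain ⟨x, rfl⟩ := (CompactOpenBisection.pointHomeomorph G).surjective x
      have e : CompactOpenBisection.pointHomeomorph G (dom x) =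
          dom (CompactOpenBisection.pointHomeomorph G x) :=
        (CompactOpenBisection.dom_point x).symm
      rw [← e]
      simp only [Homeomorph.symm_apply_apply])
  hom_inv_id := ProperCoveringFunctor.ext
    (funext fun x => (CompactOpenBisection.pointHomeomorph G).symm_apply_apply x)
  inv_hom_id := ProperCoveringFunctor.ext
    (funext fun x => (CompactOpenBisection.pointHomeomorph G).apply_symm_apply x)

theorem map_inv_of_mulEquiv {S T : Type u} [InverseSemigroup S] [InverseSemigroup T]
    (e : S ≃* T) (a : S) : e a⁻¹ = (e a)⁻¹ :=
  inv_unique _ _ (by rw [← _root_.map_mul, ← _root_.map_mul, mul_inv_mul])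
    (by rw [← _root_.map_mul, ← _root_.map_mul, inv_mul_inv])

/-- A multiplicative bijection is an isomorphism for the natural partial orders. -/
def orderIsoOfMulEquiv {S T : Type u} [InverseSemigroup S] [InverseSemigroup T]
    (e : S ≃* T) : S ≃o T where
  toEquiv := e.toEquiv
  map_rel_iff' {a b} := by
    change e a ≤ e b ↔ a ≤ b
    rw [le_def, le_def, ← map_inv_of_mulEquiv, ← _root_.map_mul, ← _root_.map_mul,
      e.injective.eq_iff]

/-- A multiplicative bijection between inverse semigroups with zero is a callitic morphism. -/
def CalliticHom.ofMulEquiv {S T : Type u} [InverseSemigroupWithZero S]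
    [InverseSemigroupWithZero T] (e : S ≃* T) : CalliticHom S T where
  toFun := e
  map_mul := _root_.map_mul e
  map_join _ _ _ _ h := (orderIsoOfMulEquiv e).isLUB_image'.2 h
  dc1 s₁ s₂ t h₁ h₂ := by
    obtain ⟨s, rfl⟩ := e.surjective t
    exact ⟨s, (orderIsoOfMulEquiv e).le_iff_le.1 h₁, (orderIsoOfMulEquiv e).le_iff_le.1 h₂, le_rfl⟩
  dc2 _ hP := hP.nonempty.preimage e.surjective

/-- A boolean inverse semigroup is isomorphic to the semigroup of compact-open bisections of its
groupoid of ultrafilters, by `s ↦ {F | s ∈ F}`. -/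
noncomputable def basicOpenEquiv (S : BooleanInvSemigrp.{u}) :
    S ≃* CompactOpenBisection
      ⟨UltrafilterSpace S, UltrafilterSpace.isBooleanGroupoid S.isBoolean⟩ :=
  MulEquiv.ofBijective
    (⟨fun s => ⟨basicOpen s, isCompact_basicOpen S.isBoolean s, isOpen_basicOpen s,
        isBisection_basicOpen s⟩,
      fun a b => CompactOpenBisection.ext (basicOpen_mul a b)⟩ :
      S →ₙ* CompactOpenBisection
        ⟨UltrafilterSpace S, UltrafilterSpace.isBooleanGroupoid S.isBoolean⟩)
    ⟨fun _ _ h => basicOpen_injective S.isBoolean (congrArg Subtype.val h), fun U => by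
      obtain ⟨s, hs⟩ := exists_eq_basicOpen S.isBoolean U.2.1 U.2.2.1 U.2.2.2
      exact ⟨s, CompactOpenBisection.ext hs⟩⟩

/-! ### The functor sending `θ` to inverse images of ultrafilters -/

/-- The map `F ↦ θ⁻¹(F)` on ultrafilters. -/
def CalliticHom.comapUltra {S T : BooleanInvSemigrp.{u}} (θ : CalliticHom S T)
    (F : UltrafilterSpace T) : UltrafilterSpace S :=
  ⟨θ.toFun ⁻¹' F.1,
    (θ.preimage_prime (F.2.prime T.isBoolean)).ultra S.isBoolean.toIsWeaklyBoolean⟩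

theorem CalliticHom.dom_comapUltra {S T : BooleanInvSemigrp.{u}} (θ : CalliticHom S T)
    (F : UltrafilterSpace T) : dom (θ.comapUltra F) = θ.comapUltra (dom F) := by
  refine UltrafilterSpace.eq_of_subset ?_
  rintro z ⟨_, ⟨a, ha, b, hb, rfl⟩, hz⟩
  refine ⟨θ.toFun a * θ.toFun b, Set.mul_mem_mul ?_ hb, ?_⟩
  · change (θ.toFun a)⁻¹ ∈ F.1
    rw [← θ.map_inv]
    exact ha
  · rw [← θ.map_mul]
    exact θ.map_le hz

theorem CalliticHom.comapUltra_inv {S T : BooleanInvSemigrp.{u}} (θ : CalliticHom S T)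
    (F : UltrafilterSpace T) : θ.comapUltra F⁻¹ = (θ.comapUltra F)⁻¹ := by
  refine Subtype.ext (Set.ext fun a => ?_)
  change (θ.toFun a)⁻¹ ∈ F.1 ↔ θ.toFun a⁻¹ ∈ F.1
  rw [θ.map_inv]

theorem CalliticHom.continuous_comapUltra {S T : BooleanInvSemigrp.{u}} (θ : CalliticHom S T) :
    Continuous θ.comapUltra := by
  refine continuous_generateFrom_iff.2 ?_
  rintro _ ⟨s, rfl⟩
  exact isOpen_basicOpen (θ.toFun s)

/-- Inverse images of ultrafilters under a callitic morphism form a proper covering functor. -/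
def CalliticHom.comapFunctor {S T : BooleanInvSemigrp.{u}} (θ : CalliticHom S T) :
    ProperCoveringFunctor (UltrafilterSpace T) (UltrafilterSpace S) where
  toFun := θ.comapUltra
  map_mul A B h := by
    have h' : Composable (θ.comapUltra A) (θ.comapUltra B) := by
      rw [composable_iff] at h ⊢
      rw [← dom_inv, θ.dom_comapUltra, h, ← dom_inv, ← θ.dom_comapUltra, θ.comapUltra_inv]
    refine ⟨h', (UltrafilterSpace.eq_of_subset ?_).symm⟩
    rintro z ⟨_, ⟨a, ha, b, hb, rfl⟩, hz⟩
    refine ⟨θ.toFun a * θ.toFun b, Set.mul_mem_mul ha hb, ?_⟩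
    rw [← θ.map_mul]
    exact θ.map_le hz
  star_inj A B hd h := by
    obtain ⟨s, hs⟩ := (θ.comapUltra A).2.prop.nonempty
    have hs' : s ∈ (θ.comapUltra B).1 := h ▸ hs
    exact UltrafilterSpace.eq_of_dom_eq (congrArg Subtype.val hd) hs hs'
  star_surj E H hE h := by
    obtain ⟨s, hs⟩ := H.2.prop.nonempty
    have hsE : s⁻¹ * s ∈ (θ.comapUltra E).1 := by
      rw [h]
      exact mem_filterDom_of_mem hs
    have hsE' : (θ.toFun s)⁻¹ * θ.toFun s ∈ E.1 := by
      rw [← θ.map_inv, ← θ.map_mul]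
      exact hsE
    -- the required arrow is the translate of `E` by `θ s`, for any `s ∈ H`
    obtain ⟨F, hsF, hd⟩ := exists_ultra_of_mem_units hE hsE'
    have hd' : dom F = E := Subtype.ext hd
    refine ⟨F, hd', UltrafilterSpace.eq_of_dom_eq (a := s) ?_ hsF hs⟩
    exact congrArg Subtype.val ((θ.dom_comapUltra F).trans (by rw [hd', h]))
  continuous := θ.continuous_comapUltra
  proper K hK := by
    have := UltrafilterSpace.t2Space S.isBoolean
    -- `K` lies in finitely many `{F | s ∈ F}`, whose inverse images `{F | θ s ∈ F}` are compact
    obtain ⟨t, ht⟩ := hK.elim_finite_subcover (fun s : S => basicOpen s) isOpen_basicOpen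
      (fun F _ => by
        obtain ⟨s, hs⟩ := F.2.prop.nonempty
        exact Set.mem_iUnion.2 ⟨s, hs⟩)
    refine (t.finite_toSet.isCompact_biUnion fun s _ =>
      isCompact_basicOpen T.isBoolean (θ.toFun s)).of_isClosed_subset
        (hK.isClosed.preimage θ.continuous_comapUltra) fun F hF => ?_
    obtain ⟨s, hs, hsF⟩ := Set.mem_iUnion₂.1 (ht hF)
    exact Set.mem_iUnion₂.2 ⟨s, hs, hsF⟩

/-- The functor that sends a boolean inverse semigroup to its groupoid of ultrafilters and a
callitic morphism `θ` to `F ↦ θ⁻¹(F)`. -/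
def ultrafilterFunctor : BooleanInvSemigrp.{u}ᵒᵖ ⥤ BooleanGrpd.{u} where
  obj S := ⟨UltrafilterSpace S.unop, UltrafilterSpace.isBooleanGroupoid S.unop.isBoolean⟩
  map θ := CalliticHom.comapFunctor θ.unop
  map_id _ := rfl
  map_comp _ _ := rfl

instance : ultrafilterFunctor.{u}.Faithful where
  map_injective {T S} θ θ' h := by
    refine Quiver.Hom.unop_inj (CalliticHom.ext (funext fun s => ?_))
    refine basicOpen_injective T.unop.isBoolean (Set.ext fun F => ?_)
    have := congrFun (congrArg ProperCoveringFunctor.toFun h) F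
    exact Set.ext_iff.1 (congrArg Subtype.val this) s

/-- A proper covering functor `α` between groupoids of ultrafilters is induced by the callitic
morphism that sends `s` to the element whose basic open set is the inverse image under `α` of the
one of `s`. -/
instance : ultrafilterFunctor.{u}.Full where
  map_surjective {T S} α := by
    let θ : CalliticHom S.unop T.unop := CalliticHom.comp
      (CalliticHom.ofMulEquiv (basicOpenEquiv T.unop).symm)
      (CalliticHom.comp (CompactOpenBisection.comapHom α)
        (CalliticHom.ofMulEquiv (basicOpenEquiv S.unop)))
    have hθ : ∀ s, basicOpen (θ.toFun s) = α.toFun ⁻¹' basicOpen s := fun s =>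
      congrArg Subtype.val ((basicOpenEquiv T.unop).apply_symm_apply
        (CompactOpenBisection.comap α (basicOpenEquiv S.unop s)))
    refine ⟨Quiver.Hom.op (X := S.unop) (Y := T.unop) θ,
      ProperCoveringFunctor.ext (funext fun F => Subtype.ext (Set.ext fun s => ?_))⟩
    exact Set.ext_iff.1 (hθ s) F

instance : ultrafilterFunctor.{u}.EssSurj where
  mem_essImage G := ⟨op ⟨CompactOpenBisection G, CompactOpenBisection.isBoolean⟩,
    ⟨(pointIso G).symm⟩⟩

instance : ultrafilterFunctor.{u}.IsEquivalence where

end NCStone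

open NCStone
/-- The category of boolean inverse semigroups and callitic morphisms is dually equivalent to the
category of boolean groupoids and proper continuous covering functors, by an equivalence that sends
`S` to (an isomorphic copy of) its groupoid of ultrafilters and `θ` to `F ↦ θ⁻¹(F)`. -/
theorem theorem3p25 :
    ∃ (e : BooleanInvSemigrp.{u}ᵒᵖ ≌ BooleanGrpd.{u})
      (φ : ∀ S : BooleanInvSemigrp.{u}, e.functor.obj (op S) ≃ₜ UltrafilterSpace S),
      (∀ S : BooleanInvSemigrp.{u}, IsUltrafilterGroupoid (φ S)) ∧
      ∀ (S T : BooleanInvSemigrp.{u}) (θ : S ⟶ T) (g : e.functor.obj (op T)),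
        (φ S ((e.functor.map θ.op).toFun g)).1 = θ.toFun ⁻¹' (φ T g).1 := by
  refine ⟨ultrafilterFunctor.asEquivalence,
    fun S => Homeomorph.refl (UltrafilterSpace S), fun S => ?_, fun S T θ g => rfl⟩
  exact ⟨fun _ _ => Iff.rfl, fun _ _ _ => rfl, fun _ => rfl⟩
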